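/- Let $p$ be a positive integer. Let $\tilde G$ be the Vilenkin group of all sequences $x=(x_j)_{j\in\mathbb Z}$ with $x_j\in\{0,\dots,p-1\}$ and $x_j=0$ for all $j<k(x)$, under coordinatewise addition $\oplus$ modulo $p$, with inverse operation $\ominus$ and with the topology in which the subgroups $U_l=\{x: x_j=0 \text{ for } j\le l\}$ $(l\in\mathbb Z)$ form a neighbourhood basis of $0$; let $\mu$ be its Haar measure with $\mu(U_0)=1$. The dual group $\tilde G^*$ consists of the same sequences, with the same operation, topology and Haar measure $\mu^*$, through the pairing $\chi(x,\omega)=\exp\bigl(\tfrac{2\pi i}{p}\sum_{j\in\mathbb Z}x_j\omega_{1-j}\bigr)$; write $U^*$ for the subgroup $U_0$ of $\tilde G^*$. For $f\in L^2(\tilde G)$, the Fourier transform $\hat f\in L^2(\tilde G^*)$ is the limit in $L^2$, as $n\to\infty$, of $\omega\mapsto\int_{U_{-n}} f(x)\overline{\chi(x,\omega)}\,d\mu(x)$. Let $H=\{x\in\tilde G: x_j=0\text{ for } j>0\}$ and let $H^\perp=\{\omega\in\tilde G^*:\chi(h,\omega)=1\text{ for all }h\in H\}$ be its annihilator. For $\phi\in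 L^2(\tilde G)$ let $T_h\phi(x)=\phi(x\ominus h)$ and let $\langle\phi\rangle$ be the closed linear span of $\{T_h\phi:h\in H\}$ in $L^2(\tilde G)$. Let $\mathbb E_\phi=\{\omega\in\tilde G^*:\sum_{h\in H^\perp}|\hat\phi(\omega\oplus h)|^2\neq 0\}$. For a closed subspace $S\subseteq L^2(\tilde G)$, let the spectrum be $\eta(S)=\{\omega\in U^*: \hat f_{\Vert\omega}\ne 0\text{ for some }f\in S\}$, where $\hat f_{\Vert\omega}=(\hat f(\omega\oplus h))_{h\in H^\perp}$; since $\hat f$ is defined only almost everywhere, the union over $f\in S$ is understood up to null sets, that is, $f$ runs over a countable dense subset of $S$ (different choices give the same set up to a null set). Then, for every $\phi\in L^2(\tilde G)$, the following are equivalent: (i) $\{T_h\phi:h\in H\}$ is a Parseval frame for $\langle\phi\rangle$, that is, $\sum_{h\in H}|\langle f,T_h\phi\rangle|^2=\|f\|^2$ for all $f\in\langle\phi\rangle$; (ii) $\sum_{h\in H^\perp}|\hat\phi(\omega\oplus h)|^2=\mathbf 1_{\mathbb E_\phi}(\omega)$ for a.e. $\omega\in\tilde G^*$; (iii) $\sum_{h\in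 H^\perp}|\hat\phi(\omega\oplus h)|^2=\mathbf 1_{\eta(\langle\phi\rangle)\oplus H^\perp}(\omega)$ for a.e. $\omega\in\tilde G^*$. -/

import Mathlib

set_option linter.unusedSectionVars false
set_option linter.style.haveILetI false

open MeasureTheory Filter Topology Set
open scoped ENNReal Pointwise

/-- The sequences `x : ℤ → ℤ/p` with `x j = 0` for all `j` below some `k = k(x)`, under
coordinatewise addition modulo `p`. -/
def vilenkinSubgroup (p : ℕ) : AddSubgroup (ℤ → ZMod p) where
  carrier := {x | ∃ k : ℤ, ∀ j < k, x j = 0}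
  zero_mem' := ⟨0, fun _ _ => rfl⟩
  add_mem' := by
    rintro x y ⟨k, hk⟩ ⟨l, hl⟩
    exact ⟨min k l, fun j hj => by
      simp [hk j (lt_of_lt_of_le hj (min_le_left _ _)), hl j (lt_of_lt_of_le hj (min_le_right _ _))]⟩
  neg_mem' := by
    rintro x ⟨k, hk⟩
    exact ⟨k, fun j hj => by simp [hk j hj]⟩

/-- The Vilenkin group. It is a type synonym of `vilenkinSubgroup p`, because its topology is not
the one induced by the product topology. -/
def Vilenkin (p : ℕ) : Type := vilenkinSubgroup p

/-- The dual group consists of the same sequences, with the same operations, topology and Haar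
measure; the duality is given by the pairing `Vilenkin.chi`. -/
abbrev VilenkinDual (p : ℕ) : Type := Vilenkin p

namespace Vilenkin

instance (p : ℕ) : AddCommGroup (Vilenkin p) := inferInstanceAs (AddCommGroup (vilenkinSubgroup p))

instance (p : ℕ) : CoeFun (Vilenkin p) (fun _ => ℤ → ZMod p) := ⟨fun x => Subtype.val x⟩

@[ext] theorem ext {p : ℕ} {x y : Vilenkin p} (h : ∀ j, x j = y j) : x = y :=
  Subtype.ext (funext h)

@[simp] theorem zero_apply {p : ℕ} (j : ℤ) : (0 : Vilenkin p) j = 0 := rfl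
@[simp] theorem add_apply {p : ℕ} (x y : Vilenkin p) (j : ℤ) : (x + y) j = x j + y j := rfl
@[simp] theorem neg_apply {p : ℕ} (x : Vilenkin p) (j : ℤ) : (-x) j = -x j := rfl
@[simp] theorem sub_apply {p : ℕ} (x y : Vilenkin p) (j : ℤ) : (x - y) j = x j - y j := by
  rw [sub_eq_add_neg, add_apply, neg_apply, sub_eq_add_neg]

/-- The subgroups `U_l = {x : x_j = 0 for j ≤ l}`. -/
def U (p : ℕ) (l : ℤ) : AddSubgroup (Vilenkin p) where
  carrier := {x | ∀ j ≤ l, x j = 0}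
  zero_mem' := fun _ _ => rfl
  add_mem' := by
    intro x y hx hy j hj
    simp [hx j hj, hy j hj]
  neg_mem' := by
    intro x hx j hj
    simp [hx j hj]

/-- The subgroup `H = {x : x_j = 0 for j > 0}`. -/
def H (p : ℕ) : AddSubgroup (Vilenkin p) where
  carrier := {x | ∀ j > 0, x j = 0}
  zero_mem' := fun _ _ => rfl
  add_mem' := by
    intro x y hx hy j hj
    simp [hx j hj, hy j hj]
  neg_mem' := by
    intro x hx j hj
    simp [hx j hj]

theorem mem_U {p : ℕ} {l : ℤ} {x : Vilenkin p} : x ∈ U p l ↔ ∀ j ≤ l, x j = 0 := Iff.rfl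

theorem mem_H {p : ℕ} {x : Vilenkin p} : x ∈ H p ↔ ∀ j > 0, x j = 0 := Iff.rfl

theorem U_anti (p : ℕ) : Antitone (U p) := fun _ _ hlm _ hx j hj => hx j (hj.trans hlm)

/-- The subgroups `U_l` as a neighbourhood basis of zero. -/
@[reducible] def basis (p : ℕ) : AddGroupFilterBasis (Vilenkin p) :=
  addGroupFilterBasisOfComm (Set.range fun l : ℤ => (U p l : Set (Vilenkin p)))
    (Set.range_nonempty _)
    (by
      rintro _ _ ⟨l, rfl⟩ ⟨m, rfl⟩
      exact ⟨_, ⟨max l m, rfl⟩,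
        Set.subset_inter (U_anti p (le_max_left l m)) (U_anti p (le_max_right l m))⟩)
    (by
      rintro _ ⟨l, rfl⟩
      exact (U p l).zero_mem)
    (by
      rintro _ ⟨l, rfl⟩
      refine ⟨_, ⟨l, rfl⟩, ?_⟩
      rintro _ ⟨x, hx, y, hy, rfl⟩
      exact (U p l).add_mem hx hy)
    (by
      rintro _ ⟨l, rfl⟩
      exact ⟨_, ⟨l, rfl⟩, fun x hx => (U p l).neg_mem hx⟩)

/-- The topology in which the cosets `x + U_l` form a neighbourhood basis at each point `x`. -/
instance (p : ℕ) : TopologicalSpace (Vilenkin p) := (basis p).topology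

instance (p : ℕ) : IsTopologicalAddGroup (Vilenkin p) := (basis p).isTopologicalAddGroup

theorem nhds_hasBasis {p : ℕ} (x : Vilenkin p) :
    (𝓝 x).HasBasis (fun _ : ℤ => True) (fun l => {y | y - x ∈ U p l}) := by
  have h := (basis p).nhds_hasBasis x
  rw [hasBasis_iff] at h ⊢
  intro t
  rw [h t]
  constructor
  · rintro ⟨_, ⟨l, rfl⟩, ht⟩
    exact ⟨l, trivial, fun y hy => ht ⟨y - x, hy, by simp⟩⟩
  · rintro ⟨l, -, ht⟩
    refine ⟨_, ⟨l, rfl⟩, ?_⟩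
    rintro _ ⟨y, hy, rfl⟩
    exact ht (by simpa using hy)

theorem isOpen_U (p : ℕ) (l : ℤ) : IsOpen (U p l : Set (Vilenkin p)) := by
  rw [isOpen_iff_mem_nhds]
  intro x hx
  exact (nhds_hasBasis x).mem_iff.2 ⟨l, trivial, fun y hy => by
    simpa using (U p l).add_mem hy hx⟩

theorem isClosed_U (p : ℕ) (l : ℤ) : IsClosed (U p l : Set (Vilenkin p)) :=
  AddSubgroup.isClosed_of_isOpen _ (isOpen_U p l)

theorem isCompact_U (p : ℕ) [NeZero p] (l : ℤ) : IsCompact (U p l : Set (Vilenkin p)) := by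
  let e : (ℤ → ZMod p) → Vilenkin p := fun a =>
    ⟨fun j => if j ≤ l then 0 else a j, l, fun j hj => if_pos hj.le⟩
  have hval : ∀ a j, (e a) j = if j ≤ l then 0 else a j := fun a j => rfl
  have he : Continuous e := by
    rw [continuous_iff_continuousAt]
    intro a
    refine (nhds_hasBasis (e a)).tendsto_right_iff.2 fun m _ => ?_
    have : ∀ᶠ b in 𝓝 a, ∀ j ∈ Set.Icc l m, b j = a j := by
      rw [eventually_all_finite (Set.finite_Icc l m)]
      intro j _
      have : Tendsto (fun b : ℤ → ZMod p => b j) (𝓝 a) (𝓝 (a j)) := (continuous_apply j).tendsto a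
      rw [nhds_discrete (ZMod p), tendsto_pure] at this
      exact this
    filter_upwards [this] with b hb j hj
    rw [sub_apply, hval, hval]
    split_ifs with h
    · simp
    · rw [hb j ⟨by omega, hj⟩, sub_self]
  have : (U p l : Set (Vilenkin p)) = Set.range e := by
    ext x
    constructor
    · intro hx
      refine ⟨x.1, ext fun j => ?_⟩
      rw [hval]
      split_ifs with h
      · exact (hx j h).symm
      · rfl
    · rintro ⟨a, rfl⟩ j hj
      rw [hval, if_pos hj]
  rw [this]
  exact isCompact_range he

instance (p : ℕ) [NeZero p] : SecondCountableTopology (Vilenkin p) := by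
  let c : (ℤ →₀ ZMod p) → Vilenkin p := fun a => ⟨a, by
    rcases a.support.eq_empty_or_nonempty with h | h
    · exact ⟨0, fun j _ => by simp [Finsupp.support_eq_empty.1 h]⟩
    · refine ⟨a.support.min' h, fun j hj => ?_⟩
      by_contra h0
      exact absurd (a.support.min'_le j (Finsupp.mem_support_iff.2 h0)) (not_le.2 hj)⟩
  let s : (ℤ →₀ ZMod p) × ℤ → Set (Vilenkin p) := fun q => {y | y - c q.1 ∈ U p q.2}
  refine (TopologicalSpace.isTopologicalBasis_of_isOpen_of_nhds (s := Set.range s) ?_ ?_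
    ).secondCountableTopology (Set.countable_range s)
  · rintro _ ⟨q, rfl⟩
    exact (isOpen_U p q.2).preimage (continuous_id.sub continuous_const)
  · intro x v hx hv
    obtain ⟨l, -, hl⟩ := (nhds_hasBasis x).mem_iff.1 (hv.mem_nhds hx)
    obtain ⟨k, hk⟩ := x.2
    have hc : ∃ a : ℤ →₀ ZMod p, ∀ j ≤ l, a j = x j := by
      refine ⟨Finsupp.onFinset (Finset.Icc k l) (fun j => if j ≤ l then x j else 0) ?_, ?_⟩
      · intro j hj
        rw [Finset.mem_Icc]
        by_cases h : j ≤ l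
        · refine ⟨?_, h⟩
          by_contra h'
          exact hj (by rw [if_pos h]; exact hk j (not_le.1 h'))
        · exact absurd (if_neg h) hj
      · intro j hj
        simp [hj]
    obtain ⟨a, ha⟩ := hc
    refine ⟨_, ⟨(a, l), rfl⟩, ?_, ?_⟩
    · intro j hj
      rw [sub_apply, sub_eq_zero]
      exact (ha j hj).symm
    · intro y hy
      refine hl fun j hj => ?_
      have := hy j hj
      rw [sub_apply, sub_eq_zero] at this ⊢
      exact this.trans (ha j hj)

instance (p : ℕ) : MeasurableSpace (Vilenkin p) := borel _

instance (p : ℕ) : BorelSpace (Vilenkin p) := ⟨rfl⟩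

/-- `U = U_0`, as a compact set with non-empty interior. -/
def unitCompact (p : ℕ) [NeZero p] : TopologicalSpace.PositiveCompacts (Vilenkin p) where
  carrier := U p 0
  isCompact' := isCompact_U p 0
  interior_nonempty' := by
    rw [(isOpen_U p 0).interior_eq]
    exact ⟨0, (U p 0).zero_mem⟩

instance (p : ℕ) [NeZero p] : LocallyCompactSpace (Vilenkin p) :=
  (unitCompact p).locallyCompactSpace_of_addGroup

/-- The Haar measure normalized by `haar p (U p 0) = 1`. -/
noncomputable def haar (p : ℕ) [NeZero p] : Measure (Vilenkin p) :=
  Measure.addHaarMeasure (unitCompact p)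

instance (p : ℕ) [NeZero p] : (haar p).IsAddHaarMeasure :=
  inferInstanceAs (Measure.addHaarMeasure (unitCompact p)).IsAddHaarMeasure

theorem haar_U_zero (p : ℕ) [NeZero p] : haar p (U p 0) = 1 :=
  Measure.addHaarMeasure_self (K₀ := unitCompact p)

noncomputable abbrev L2 (p : ℕ) [NeZero p] : Type := Lp ℂ 2 (haar p)

instance (p : ℕ) [NeZero p] : SecondCountableTopology (L2 p) := by
  have : Fact ((2 : ℝ≥0∞) ≠ ∞) := ⟨by simp⟩
  infer_instance


/-- The pairing `χ(x, ω) = exp ((2πi / p) ∑ j, x_j ω_{1-j})`; the sum has finitely many non-zero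
terms, and `ZMod.stdAddChar` is `t ↦ exp (2πi t / p)`. -/
noncomputable def chi {p : ℕ} [NeZero p] (x : Vilenkin p) (ω : VilenkinDual p) : ℂ :=
  ZMod.stdAddChar (∑ᶠ j : ℤ, x j * ω (1 - j))

theorem finite_support {p : ℕ} (x ω : Vilenkin p) :
    (Function.support fun j : ℤ => x j * ω (1 - j)).Finite := by
  obtain ⟨k, hk⟩ := x.2
  obtain ⟨l, hl⟩ := ω.2
  refine (Set.finite_Icc k (1 - l)).subset fun j hj => ?_
  by_contra h
  apply hj
  rw [Set.mem_Icc, not_and_or, not_le, not_le] at h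
  rcases h with h | h
  · exact (congrArg (· * _) (hk j h)).trans (zero_mul _)
  · exact (congrArg (_ * ·) (hl (1 - j) (by omega))).trans (mul_zero _)

section
variable {p : ℕ} [NeZero p]

theorem chi_add_left (x y ω : Vilenkin p) : chi (x + y) ω = chi x ω * chi y ω := by
  rw [chi, chi, chi, ← AddChar.map_add_eq_mul,
    ← finsum_add_distrib (finite_support x ω) (finite_support y ω)]
  simp only [add_apply, add_mul]

theorem chi_add_right (x ω ν : Vilenkin p) : chi x (ω + ν) = chi x ω * chi x ν := by
  rw [chi, chi, chi, ← AddChar.map_add_eq_mul,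
    ← finsum_add_distrib (finite_support x ω) (finite_support x ν)]
  simp only [add_apply, mul_add]

theorem chi_zero_right (x : Vilenkin p) : chi x 0 = 1 := by simp [chi]

theorem norm_chi (x ω : Vilenkin p) : ‖chi x ω‖ = 1 := by
  rw [chi, ZMod.stdAddChar_apply, Circle.norm_coe]

theorem chi_neg_right (x ω : Vilenkin p) : chi x (-ω) = (starRingEnd ℂ) (chi x ω) := by
  have h : chi x (-ω) * chi x ω = 1 := by rw [← chi_add_right, neg_add_cancel, chi_zero_right]
  have h2 : (starRingEnd ℂ) (chi x ω) * chi x ω = 1 := by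
    rw [mul_comm, Complex.mul_conj, Complex.normSq_eq_norm_sq, norm_chi]; simp
  have h3 : chi x ω ≠ 0 := by
    intro h0
    have := norm_chi x ω
    simp [h0] at this
  exact mul_right_cancel₀ h3 (h.trans h2.symm)

end

/-- The annihilator `{ω : χ(x, ω) = 1 for all x ∈ K}` of a subgroup `K`. -/
def annihilator {p : ℕ} [NeZero p] (K : AddSubgroup (Vilenkin p)) :
    AddSubgroup (VilenkinDual p) where
  carrier := {ω | ∀ x ∈ K, chi x ω = 1}
  zero_mem' := fun x _ => chi_zero_right x
  add_mem' := by
    intro ω ν hω hν x hx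
    rw [chi_add_right, hω x hx, hν x hx, mul_one]
  neg_mem' := by
    intro ω hω x hx
    rw [chi_neg_right, hω x hx, map_one]

/-- The annihilator of `H`. -/
noncomputable abbrev Hperp (p : ℕ) [NeZero p] : AddSubgroup (VilenkinDual p) := annihilator (H p)

section
variable {p : ℕ} [NeZero p]

/-- The sequence with the single entry `c` at place `i`. -/
def single (i : ℤ) (c : ZMod p) : Vilenkin p :=
  ⟨fun j => if j = i then c else 0, i, fun _ hj => if_neg hj.ne⟩

theorem single_apply (i : ℤ) (c : ZMod p) (j : ℤ) : single i c j = if j = i then c else 0 := rfl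

theorem chi_single (i : ℤ) (ω : Vilenkin p) :
    chi (single i 1) ω = ZMod.stdAddChar (ω (1 - i)) := by
  rw [chi, finsum_eq_single _ i]
  · simp [single_apply]
  · intro j hj
    simp [single_apply, hj]

theorem eq_zero_of_chi_single {i : ℤ} {ω : Vilenkin p} (h : chi (single (1 - i) 1) ω = 1) :
    ω i = 0 := by
  rw [chi_single, sub_sub_cancel] at h
  exact ZMod.injective_stdAddChar (h.trans (AddChar.map_zero_eq_one _).symm)

theorem mem_Hperp {ω : VilenkinDual p} : ω ∈ Hperp p ↔ ∀ j > 0, ω j = 0 := by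
  constructor
  · intro h j hj
    refine eq_zero_of_chi_single (h _ fun i hi => ?_)
    rw [single_apply, if_neg (by omega)]
  · intro h x hx
    rw [chi, finsum_eq_zero_of_forall_eq_zero, AddChar.map_zero_eq_one]
    intro j
    by_cases hj : 0 < j
    · rw [hx j hj, zero_mul]
    · rw [h (1 - j) (by omega), mul_zero]

theorem chi_eq_one {l : ℤ} {x ω : Vilenkin p} (hx : x ∈ U p l) (hω : ω ∈ U p (-l)) :
    chi x ω = 1 := by
  rw [chi, finsum_eq_zero_of_forall_eq_zero, AddChar.map_zero_eq_one]
  intro j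
  by_cases hj : j ≤ l
  · rw [hx j hj, zero_mul]
  · rw [hω (1 - j) (by omega), mul_zero]

theorem exists_mem_U (x : Vilenkin p) : ∃ l, x ∈ U p l := by
  obtain ⟨k, hk⟩ := x.2
  exact ⟨k - 1, fun j hj => hk j (by omega)⟩

theorem continuous_chi (ω : Vilenkin p) : Continuous fun x => chi x ω := by
  rw [continuous_iff_continuousAt]
  intro x
  obtain ⟨l, hl⟩ := exists_mem_U ω
  have : (fun y => chi y ω) =ᶠ[𝓝 x] fun _ => chi x ω := by
    filter_upwards [(nhds_hasBasis x).mem_of_mem (i := -l) trivial] with y hy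
    have h := chi_add_left (y - x) x ω
    rw [sub_add_cancel] at h
    rw [h, chi_eq_one hy (by simpa using hl), one_mul]
  exact this.continuousAt

theorem measurableSet_U (l : ℤ) : MeasurableSet (U p l : Set (Vilenkin p)) :=
  (isOpen_U p l).measurableSet

theorem haar_U_lt_top (l : ℤ) : haar p (U p l) < ∞ := (isCompact_U p l).measure_lt_top

theorem haar_U_pos (l : ℤ) : 0 < haar p (U p l) :=
  (isOpen_U p l).measure_pos _ ⟨0, (U p l).zero_mem⟩

theorem haar_U_succ (l : ℤ) : haar p (U p l) = p * haar p (U p (l + 1)) := by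
  have h : (U p l : Set (Vilenkin p)) =
      ⋃ c : ZMod p, (fun x => x + single (l + 1) (-c)) ⁻¹' (U p (l + 1)) := by
    ext x
    simp only [Set.mem_iUnion, Set.mem_preimage, SetLike.mem_coe, mem_U, add_apply, single_apply]
    constructor
    · intro hx
      refine ⟨x (l + 1), fun j hj => ?_⟩
      split_ifs with h
      · simp [h]
      · simp [hx j (by omega)]
    · rintro ⟨c, hc⟩ j hj
      have := hc j (by omega)
      rwa [if_neg (by omega), add_zero] at this
  rw [h, measure_iUnion]
  · simp only [measure_preimage_add_right, tsum_fintype, Finset.sum_const, Finset.card_univ,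
      ZMod.card, nsmul_eq_mul]
  · intro c d hcd
    rw [Function.onFun, Set.disjoint_left]
    intro x hc hd
    have h1 := hc (l + 1) le_rfl
    have h2 := hd (l + 1) le_rfl
    simp only [add_apply, single_apply, if_true] at h1 h2
    exact hcd (neg_injective (add_left_cancel (h1.trans h2.symm)))
  · intro c
    exact (measurableSet_U _).preimage (measurable_add_const _)

theorem haar_U_mul (l : ℤ) : haar p (U p l) * haar p (U p (-l)) = 1 := by
  have key : ∀ n : ℕ, haar p (U p n) * haar p (U p (-n)) = 1 := by
    intro n
    induction n with
    | zero => simp [haar_U_zero]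
    | succ n ih =>
      rw [haar_U_succ (n : ℤ), ← Nat.cast_succ] at ih
      rw [haar_U_succ (-((n + 1 : ℕ) : ℤ)), ← ih]
      have : -((n + 1 : ℕ) : ℤ) + 1 = -n := by push_cast; ring
      rw [this]
      ring
  rcases l.eq_nat_or_neg with ⟨n, rfl | rfl⟩
  · exact key n
  · rw [neg_neg, mul_comm]
    exact key n

/-- `∫_{U_l} f(x) conj χ(x, ω) dμ(x)`. -/
noncomputable def truncFourier (l : ℤ) (f : Vilenkin p → ℂ) (ω : VilenkinDual p) : ℂ :=
  ∫ x in (U p l : Set (Vilenkin p)), f x * (starRingEnd ℂ) (chi x ω) ∂(haar p)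

theorem integral_chi {l : ℤ} {ω : Vilenkin p} (hω : ω ∉ U p (-l)) :
    ∫ x in (U p l : Set (Vilenkin p)), chi x ω ∂(haar p) = 0 := by
  rw [mem_U] at hω
  push Not at hω
  obtain ⟨i, hi, h0⟩ := hω
  set y : Vilenkin p := single (1 - i) 1
  have hy : y ∈ U p l := fun j hj => by
    rw [single_apply, if_neg (by omega)]
  have hne : chi y ω ≠ 1 := fun h => h0 (eq_zero_of_chi_single h)
  rw [← integral_indicator (measurableSet_U l)]
  set I := ∫ x, (U p l : Set (Vilenkin p)).indicator (fun x => chi x ω) x ∂(haar p) with hI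
  have h : I = chi y ω * I := by
    rw [← integral_const_mul, hI, ← integral_add_right_eq_self _ y]
    congr 1
    ext x
    by_cases hx : x ∈ U p l
    · rw [Set.indicator_of_mem (show x + y ∈ (U p l : Set _) from (U p l).add_mem hx hy),
        Set.indicator_of_mem (show x ∈ (U p l : Set _) from hx), chi_add_left, mul_comm]
    · rw [Set.indicator_of_notMem, Set.indicator_of_notMem, mul_zero]
      · exact hx
      · intro h
        exact hx (by simpa using (U p l).sub_mem h hy)
  have h' : (chi y ω - 1) * I = 0 := by rw [sub_mul, one_mul, ← h, sub_self]
  exact (mul_eq_zero.1 h').resolve_left (sub_ne_zero.2 hne)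

theorem truncFourier_add_mem {l : ℤ} (f : Vilenkin p → ℂ) (ω : Vilenkin p) {ν : Vilenkin p}
    (hν : ν ∈ U p (-l)) : truncFourier l f (ω + ν) = truncFourier l f ω := by
  refine setIntegral_congr_fun (measurableSet_U l) fun x hx => ?_
  simp only [chi_add_right, chi_eq_one hx hν, mul_one]

theorem continuous_truncFourier (l : ℤ) (f : Vilenkin p → ℂ) : Continuous (truncFourier l f) := by
  rw [continuous_iff_continuousAt]
  intro ω
  have : truncFourier l f =ᶠ[𝓝 ω] fun _ => truncFourier l f ω := by
    filter_upwards [(nhds_hasBasis ω).mem_of_mem (i := -l) trivial] with ν hν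
    have := truncFourier_add_mem f ω hν
    rwa [add_sub_cancel] at this
  exact this.continuousAt

theorem memLp_indicator_chi (l : ℤ) (d : Vilenkin p) :
    MemLp ((U p l : Set (Vilenkin p)).indicator fun x => chi x d) 2 (haar p) := by
  have : IsFiniteMeasure ((haar p).restrict (U p l : Set (Vilenkin p))) :=
    ⟨by simpa using haar_U_lt_top l⟩
  rw [memLp_indicator_iff_restrict (measurableSet_U l)]
  exact MemLp.of_bound (continuous_chi d).aestronglyMeasurable 1
    (Eventually.of_forall fun x => (norm_chi x d).le)

/-- The characters restricted to `U_l`, as elements of `L²`. -/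
noncomputable def charLp (l : ℤ) (d : Vilenkin p) : L2 p := (memLp_indicator_chi l d).toLp

theorem inner_charLp (l : ℤ) (d : Vilenkin p) (f : L2 p) :
    inner ℂ (charLp l d) f = truncFourier l f d := by
  rw [L2.inner_def, truncFourier, ← integral_indicator (measurableSet_U l)]
  refine integral_congr_ae ?_
  filter_upwards [(memLp_indicator_chi l d).coeFn_toLp] with x hx
  rw [charLp, hx]
  by_cases h : x ∈ (U p l : Set (Vilenkin p))
  · rw [Set.indicator_of_mem h, Set.indicator_of_mem h, RCLike.inner_apply]
  · rw [Set.indicator_of_notMem h, Set.indicator_of_notMem h, inner_zero_left]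

theorem inner_charLp_charLp (l : ℤ) (d e : Vilenkin p) :
    inner ℂ (charLp l d) (charLp l e) =
      ∫ x in (U p l : Set (Vilenkin p)), chi x (e - d) ∂(haar p) := by
  rw [inner_charLp, truncFourier]
  refine integral_congr_ae ?_
  filter_upwards [ae_restrict_of_ae (memLp_indicator_chi l e).coeFn_toLp,
    ae_restrict_mem (measurableSet_U l)] with x hx hxU
  rw [charLp, hx, Set.indicator_of_mem hxU, sub_eq_add_neg, chi_add_right, chi_neg_right]

theorem orthonormal_charLp (l : ℤ) :
    Orthonormal ℂ fun q : Vilenkin p ⧸ U p (-l) =>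
      ((Real.sqrt ((haar p).real (U p l)))⁻¹ : ℂ) • charLp l q.out := by
  have hpos : 0 < (haar p).real (U p l : Set (Vilenkin p)) :=
    ENNReal.toReal_pos (haar_U_pos l).ne' (haar_U_lt_top l).ne
  classical
  rw [orthonormal_iff_ite]
  intro q r
  rw [inner_smul_left, inner_smul_right, inner_charLp_charLp]
  split_ifs with h
  · subst h
    simp only [sub_self, chi_zero_right, integral_const, MeasurableSet.univ, measureReal_restrict_apply,
      Set.univ_inter]
    rw [map_inv₀, Complex.conj_ofReal, ← mul_assoc, ← mul_inv, ← Complex.ofReal_mul,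
      Real.mul_self_sqrt hpos.le, Complex.real_smul, mul_one, inv_mul_cancel₀]
    exact_mod_cast hpos.ne'
  · rw [integral_chi, mul_zero, mul_zero]
    intro hmem
    apply h
    rw [← q.out_eq, ← r.out_eq]
    exact QuotientAddGroup.eq.2 (by simpa [sub_eq_neg_add] using hmem)

instance countable_quotient (l : ℤ) : Countable (Vilenkin p ⧸ U p l) := by
  have : DiscreteTopology (Vilenkin p ⧸ U p l) := QuotientAddGroup.discreteTopology (isOpen_U p l)
  exact TopologicalSpace.separableSpace_iff_countable.1 inferInstance

theorem lintegral_truncFourier_le (l : ℤ) (f : L2 p) :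
    ∫⁻ ω, ‖truncFourier l f ω‖ₑ ^ 2 ∂(haar p) ≤ ‖f‖ₑ ^ 2 := by
  let s : Vilenkin p ⧸ U p (-l) → Set (Vilenkin p) := fun q => QuotientAddGroup.mk ⁻¹' {q}
  have hs : ∀ q, s q = (fun x => x + -q.out) ⁻¹' (U p (-l)) := by
    intro q
    ext x
    have : (x : Vilenkin p ⧸ U p (-l)) = q ↔ -q.out + x ∈ U p (-l) := by
      rw [← QuotientAddGroup.eq, QuotientAddGroup.out_eq', eq_comm]
    simpa [s, add_comm x] using this
  have hm : ∀ q, MeasurableSet (s q) := fun q => by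
    rw [hs]; exact (measurableSet_U _).preimage (measurable_add_const _)
  have hU : ⋃ q, s q = Set.univ := by
    ext x; simp [s]
  rw [← setLIntegral_univ, ← hU, lintegral_iUnion hm]
  · have hq : ∀ q, ∫⁻ ω in s q, ‖truncFourier l f ω‖ₑ ^ 2 ∂(haar p) =
        ‖inner ℂ (((Real.sqrt ((haar p).real (U p l)))⁻¹ : ℂ) • charLp l q.out) f‖ₑ ^ 2 := by
      intro q
      have h1 : ∫⁻ ω in s q, ‖truncFourier l f ω‖ₑ ^ 2 ∂(haar p) =
          ∫⁻ ω in s q, ‖truncFourier l f q.out‖ₑ ^ 2 ∂(haar p) := by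
        refine setLIntegral_congr_fun (hm q) fun ω hω => ?_
        rw [hs] at hω
        have := truncFourier_add_mem f q.out hω
        have he : q.out + (fun x => x + -q.out) ω = ω := by simp
        rw [he] at this
        simp only [this]
      rw [h1, setLIntegral_const, hs, measure_preimage_add_right, inner_smul_left, inner_charLp,
        enorm_mul, mul_pow, mul_comm]
      congr 1
      have hpos : 0 < (haar p).real (U p l : Set (Vilenkin p)) :=
        ENNReal.toReal_pos (haar_U_pos l).ne' (haar_U_lt_top l).ne
      rw [map_inv₀, Complex.conj_ofReal, ← Complex.ofReal_inv, ← ofReal_norm,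
        Complex.norm_real, Real.norm_of_nonneg (by positivity), ← ENNReal.ofReal_pow (by positivity),
        inv_pow, Real.sq_sqrt hpos.le, ENNReal.ofReal_inv_of_pos hpos, ofReal_measureReal
        (haar_U_lt_top l).ne]
      exact ENNReal.eq_inv_of_mul_eq_one_left (by rw [mul_comm]; exact haar_U_mul l)
    simp_rw [hq]
    have hb := (orthonormal_charLp (p := p) l).tsum_inner_products_le f
    have hsum := (orthonormal_charLp (p := p) l).inner_products_summable f
    calc _ = ∑' q, ENNReal.ofReal (‖inner ℂ (((Real.sqrt ((haar p).real (U p l)))⁻¹ : ℂ) •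
              charLp l (Quotient.out q)) f‖ ^ 2) := by
            congr 1; ext q
            rw [ENNReal.ofReal_pow (norm_nonneg _), ofReal_norm]
      _ = ENNReal.ofReal (∑' q, ‖inner ℂ (((Real.sqrt ((haar p).real (U p l)))⁻¹ : ℂ) •
              charLp l (Quotient.out q)) f‖ ^ 2) :=
            (ENNReal.ofReal_tsum_of_nonneg (fun _ => by positivity) hsum).symm
      _ ≤ ENNReal.ofReal (‖f‖ ^ 2) := ENNReal.ofReal_le_ofReal hb
      _ = ‖f‖ₑ ^ 2 := by rw [ENNReal.ofReal_pow (norm_nonneg _), ofReal_norm]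
  · intro q r hqr
    exact Disjoint.preimage _ (by simpa using hqr)

theorem eLpNorm_truncFourier_le (l : ℤ) (f : L2 p) :
    eLpNorm (truncFourier l f) 2 (haar p) ≤ ‖f‖ₑ := by
  rw [eLpNorm_eq_lintegral_rpow_enorm_toReal (by simp) (by simp)]
  have := lintegral_truncFourier_le l f
  simp only [ENNReal.toReal_ofNat, ENNReal.rpow_ofNat]
  calc _ ≤ (‖f‖ₑ ^ 2) ^ (1 / 2 : ℝ) := by gcongr
    _ = ‖f‖ₑ := by
      rw [← ENNReal.rpow_natCast, ← ENNReal.rpow_mul]; simp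

theorem memLp_truncFourier (l : ℤ) (f : L2 p) : MemLp (truncFourier l f) 2 (haar p) :=
  ⟨(continuous_truncFourier l f).aestronglyMeasurable,
    (eLpNorm_truncFourier_le l f).trans_lt enorm_lt_top⟩

end

/-- `ω ↦ ∫_{U_l} f(x) conj χ(x, ω) dμ(x)` as an element of `L²`. -/
noncomputable def truncFourierLp {p : ℕ} [NeZero p] (l : ℤ) (f : L2 p) :
    Lp ℂ 2 (haar p : Measure (VilenkinDual p)) :=
  (memLp_truncFourier l f).toLp

section
variable {p : ℕ} [NeZero p]

theorem norm_truncFourierLp_le (l : ℤ) (f : L2 p) : ‖truncFourierLp l f‖ ≤ ‖f‖ := by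
  rw [truncFourierLp, Lp.norm_toLp]
  exact ENNReal.toReal_le_of_le_ofReal (norm_nonneg _)
    ((eLpNorm_truncFourier_le l f).trans_eq (ofReal_norm f).symm)

theorem integrableOn_mul_chi (l : ℤ) (f : L2 p) (ω : Vilenkin p) :
    IntegrableOn (fun x => f x * (starRingEnd ℂ) (chi x ω)) (U p l : Set (Vilenkin p))
      (haar p) := by
  have : IsFiniteMeasure ((haar p).restrict (U p l : Set (Vilenkin p))) :=
    ⟨by simpa using haar_U_lt_top l⟩
  have hf : Integrable f ((haar p).restrict (U p l : Set (Vilenkin p))) :=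
    ((Lp.memLp f).restrict _).integrable (by norm_num)
  refine hf.mul_bdd (c := 1) ?_ (Eventually.of_forall fun x => ?_)
  · exact (Complex.continuous_conj.comp (continuous_chi ω)).aestronglyMeasurable
  · rw [RCLike.norm_conj, norm_chi]

theorem truncFourierLp_sub (l : ℤ) (f g : L2 p) :
    truncFourierLp l (f - g) = truncFourierLp l f - truncFourierLp l g := by
  rw [truncFourierLp, truncFourierLp, truncFourierLp, ← MemLp.toLp_sub]
  refine MemLp.toLp_congr _ _ (Eventually.of_forall fun ω => ?_)
  rw [Pi.sub_apply, truncFourier, truncFourier, truncFourier,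
    ← integral_sub (integrableOn_mul_chi l f ω) (integrableOn_mul_chi l g ω)]
  refine integral_congr_ae ?_
  filter_upwards [ae_restrict_of_ae (Lp.coeFn_sub f g)] with x hx
  rw [hx, Pi.sub_apply, sub_mul]

/-- The restriction `f · 1_{U_l}` as an element of `L²`. -/
noncomputable def cut (l : ℤ) (f : L2 p) : L2 p :=
  ((Lp.memLp f).indicator (measurableSet_U l)).toLp

theorem truncFourierLp_cut {l m : ℤ} (h : l ≤ m) (f : L2 p) :
    truncFourierLp l (cut m f) = truncFourierLp m f := by
  refine MemLp.toLp_congr _ _ (Eventually.of_forall fun ω => ?_)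
  have hsub : (U p m : Set (Vilenkin p)) ⊆ U p l := U_anti p h
  rw [truncFourier, truncFourier, ← Set.inter_eq_self_of_subset_right hsub,
    ← setIntegral_indicator (measurableSet_U m)]
  refine integral_congr_ae ?_
  filter_upwards [ae_restrict_of_ae ((Lp.memLp f).indicator (measurableSet_U m)).coeFn_toLp]
    with x hx
  rw [cut, hx]
  by_cases hxm : x ∈ (U p m : Set (Vilenkin p))
  · rw [Set.indicator_of_mem hxm, Set.indicator_of_mem hxm]
  · rw [Set.indicator_of_notMem hxm, Set.indicator_of_notMem hxm, zero_mul]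

theorem tendsto_cut (f : L2 p) : Tendsto (fun n : ℕ => cut (-n) f) atTop (𝓝 f) := by
  rw [Lp.tendsto_Lp_iff_tendsto_eLpNorm']
  have hrw : ∀ n : ℕ, eLpNorm (⇑(cut (-n) f) - ⇑f) 2 (haar p) =
      (∫⁻ x, ((U p (-n) : Set (Vilenkin p))ᶜ).indicator (fun x => ‖f x‖ₑ ^ 2) x ∂(haar p))
        ^ (1 / 2 : ℝ) := by
    intro n
    rw [eLpNorm_eq_lintegral_rpow_enorm_toReal (by simp) (by simp)]
    simp only [ENNReal.toReal_ofNat, ENNReal.rpow_ofNat]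
    congr 1
    refine lintegral_congr_ae ?_
    filter_upwards [((Lp.memLp f).indicator (measurableSet_U (-n))).coeFn_toLp] with x hx
    rw [Pi.sub_apply, cut, hx]
    by_cases h : x ∈ (U p (-n) : Set (Vilenkin p))
    · rw [Set.indicator_of_mem h, Set.indicator_of_notMem (by simpa using h)]
      simp
    · rw [Set.indicator_of_notMem h, Set.indicator_of_mem (by simpa using h)]
      simp
  simp_rw [hrw]
  have hfin : ∫⁻ x, ‖f x‖ₑ ^ 2 ∂(haar p) ≠ ∞ := by
    have := lintegral_rpow_enorm_lt_top_of_eLpNorm_lt_top (by simp) (by simp) (Lp.memLp f).2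
    simpa using this.ne
  have hm : AEMeasurable (fun x => ‖f x‖ₑ ^ 2) (haar p) :=
    (Lp.aestronglyMeasurable f).enorm.pow_const 2
  have h0 : Tendsto (fun n : ℕ => ∫⁻ x, ((U p (-n) : Set (Vilenkin p))ᶜ).indicator
      (fun x => ‖f x‖ₑ ^ 2) x ∂(haar p)) atTop (𝓝 (∫⁻ _, 0 ∂(haar p))) := by
    refine tendsto_lintegral_of_dominated_convergence' (fun x => ‖f x‖ₑ ^ 2)
      (fun n => hm.indicator (measurableSet_U _).compl)
      (fun n => Eventually.of_forall fun x => Set.indicator_le_self _ _ x) hfin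
      (Eventually.of_forall fun x => ?_)
    obtain ⟨l, hl⟩ := exists_mem_U x
    refine tendsto_const_nhds.congr' ?_
    filter_upwards [eventually_ge_atTop l.natAbs] with n hn
    rw [Set.indicator_of_notMem]
    exact fun h => h (U_anti p (by omega : -(n : ℤ) ≤ l) hl)
  have := (ENNReal.continuous_rpow_const (y := 1 / 2)).tendsto _ |>.comp h0
  simpa [Function.comp_def] using this

theorem cauchySeq_truncFourierLp (f : L2 p) :
    CauchySeq fun n : ℕ => truncFourierLp (-n) f := by
  refine cauchySeq_of_le_tendsto_0 (fun N : ℕ => 2 * ‖f - cut (-N) f‖) ?_ ?_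
  · have key : ∀ n N : ℕ, N ≤ n →
        ‖truncFourierLp (-n) f - truncFourierLp (-N) f‖ ≤ ‖f - cut (-N) f‖ := by
      intro n N h
      rw [← truncFourierLp_cut (by omega : -(n : ℤ) ≤ -N) f, ← truncFourierLp_sub]
      exact norm_truncFourierLp_le _ _
    intro n m N hn hm
    have h1 := key n N hn
    have h2 := key m N hm
    rw [← dist_eq_norm] at h1 h2
    linarith [dist_triangle_right (truncFourierLp (-n) f) (truncFourierLp (-m) f)
      (truncFourierLp (-N) f)]
  · have h := (tendsto_const_nhds (x := f)).sub (tendsto_cut f)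
    simpa using h.norm.const_mul 2

end

/-- The Fourier transform on `L²`: the limit in `L²` of the integrals
`ω ↦ ∫_{U_{-n}} f(x) conj χ(x, ω) dμ(x)` as `n → ∞`. -/
noncomputable def fourier {p : ℕ} [NeZero p] (f : L2 p) :
    Lp ℂ 2 (haar p : Measure (VilenkinDual p)) :=
  limUnder atTop fun n : ℕ => truncFourierLp (-n) f

section
variable {p : ℕ} [NeZero p]

/-- The limit in the definition of the Fourier transform exists for every `f`. -/
theorem tendsto_fourier (f : L2 p) :
    Tendsto (fun n : ℕ => truncFourierLp (-n) f) atTop (𝓝 (fourier f)) :=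
  (cauchySeq_truncFourierLp f).tendsto_limUnder

theorem dist_fourier_le (f g : L2 p) : dist (fourier f) (fourier g) ≤ dist f g := by
  refine le_of_tendsto ((tendsto_fourier f).dist (tendsto_fourier g))
    (Eventually.of_forall fun n => ?_)
  rw [dist_eq_norm, dist_eq_norm, ← truncFourierLp_sub]
  exact norm_truncFourierLp_le _ _

theorem continuous_fourier : Continuous (fourier (p := p)) :=
  (LipschitzWith.of_dist_le_mul (K := 1) fun f g => by
    simpa using dist_fourier_le f g).continuous

end

/-- The translation `T_h φ (x) = φ (x ⊖ h)` on `L²`. -/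
noncomputable def translate {p : ℕ} [NeZero p] (h : Vilenkin p) (φ : L2 p) : L2 p :=
  Lp.compMeasurePreserving (fun x => x - h) (measurePreserving_sub_right (haar p) h) φ

/-- The principal shift invariant space `⟨φ⟩`, the closed linear span of the `T_h φ`, `h ∈ H`. -/
noncomputable def principal {p : ℕ} [NeZero p] (φ : L2 p) : Submodule ℂ (L2 p) :=
  (Submodule.span ℂ (Set.range fun h : H p => translate (h : Vilenkin p) φ)).topologicalClosure

/-- The periodization `P_f(ω) = ∑_{h ∈ H^⊥} |f̂(ω ⊕ h)|²`, with values in `[0, ∞]`. -/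
noncomputable def periodization {p : ℕ} [NeZero p] (f : L2 p) (ω : VilenkinDual p) : ℝ≥0∞ :=
  ∑' h : Hperp p, ‖fourier f (ω + h)‖ₑ ^ 2

/-- `E_f = {ω : P_f(ω) ≠ 0}`. -/
def supportSet {p : ℕ} [NeZero p] (f : L2 p) : Set (VilenkinDual p) :=
  {ω | periodization f ω ≠ 0}

/-- The fibre `(f̂(ω ⊕ h))_{h ∈ H^⊥}` of `f` at `ω`. -/
noncomputable def fiber {p : ℕ} [NeZero p] (f : L2 p) (ω : VilenkinDual p) : Hperp p → ℂ :=
  fun h => fourier f (ω + h)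

/-- The spectrum `η(S) = {ω ∈ U* : some f ∈ S has a non-zero fibre at ω}`. As fibres are defined up
to null sets only, the union over the uncountable space `S` is taken along a dense sequence in `S`;
`ae_mem_spectrum_of_fiber_ne_zero` shows that this captures every `f ∈ S` up to a null set, so that
another dense sequence gives the same set up to a null set. -/
def spectrum {p : ℕ} [NeZero p] (S : Submodule ℂ (L2 p)) : Set (VilenkinDual p) :=
  {ω | ω ∈ U p 0 ∧ ∃ n : ℕ, fiber (TopologicalSpace.denseSeq S n : L2 p) ω ≠ 0}

section
variable {p : ℕ} [NeZero p]

theorem countable_Hperp : Countable (Hperp p) := by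
  have hinj : Function.Injective
      (fun h : Hperp p => (QuotientAddGroup.mk (h : Vilenkin p) : Vilenkin p ⧸ U p 0)) := by
    intro g h hgh
    have h1 := QuotientAddGroup.eq.1 hgh
    refine Subtype.ext (ext fun j => ?_)
    rcases le_or_gt j 0 with hj | hj
    · have := h1 j hj
      rw [add_apply, neg_apply] at this
      exact (neg_add_eq_zero.1 this)
    · rw [mem_Hperp.1 g.2 j hj, mem_Hperp.1 h.2 j hj]
  exact hinj.countable

theorem ae_mem_spectrum_of_fiber_ne_zero {S : Submodule ℂ (L2 p)} {f : L2 p} (hf : f ∈ S) :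
    ∀ᵐ ω ∂(haar p : Measure (VilenkinDual p)),
      ω ∈ U p 0 → fiber f ω ≠ 0 → ω ∈ spectrum S := by
  have hcl : (⟨f, hf⟩ : S) ∈ closure (Set.range (TopologicalSpace.denseSeq S)) :=
    TopologicalSpace.denseRange_denseSeq S _
  obtain ⟨u, hu, hlim⟩ := mem_closure_iff_seq_limit.1 hcl
  have h1 : Tendsto (fun n => fourier (u n : L2 p)) atTop (𝓝 (fourier f)) :=
    (continuous_fourier.tendsto f).comp ((continuous_subtype_val.tendsto _).comp hlim)
  obtain ⟨ns, -, hae⟩ := TendstoInMeasure.exists_seq_tendsto_ae (tendstoInMeasure_of_tendsto_Lp h1)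
  have := countable_Hperp (p := p)
  have hall : ∀ᵐ ω ∂(haar p : Measure (VilenkinDual p)), ∀ h : Hperp p,
      Tendsto (fun i => fourier (u (ns i) : L2 p) (ω + h)) atTop (𝓝 (fourier f (ω + h))) := by
    rw [ae_all_iff]
    intro h
    have hq := (measurePreserving_add_right (haar p) (h : Vilenkin p)).quasiMeasurePreserving
    filter_upwards [hq.tendsto_ae.eventually hae] with ω hω using hω
  filter_upwards [hall] with ω hω hU hne
  by_contra hnot
  apply hne
  funext h
  refine tendsto_nhds_unique (hω h) (tendsto_const_nhds.congr fun i => ?_)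
  obtain ⟨n, hn⟩ := hu (ns i)
  by_contra h0
  refine hnot ⟨hU, n, fun hz => h0 ?_⟩
  have := congrFun hz h
  rw [hn] at this
  exact this.symm

end

end Vilenkin

/-- `(f_j)` is a frame for the closed subspace `V`, with frame bounds `a` and `b`. -/
structure IsFrameFor {E J : Type*} [NormedAddCommGroup E] [InnerProductSpace ℂ E]
    (V : Submodule ℂ E) (f : J → E) (a b : ℝ) : Prop where
  pos : 0 < a
  le : a ≤ b
  mem : ∀ j, f j ∈ V
  lower : ∀ v ∈ V, ENNReal.ofReal (a * ‖v‖ ^ 2) ≤ ∑' j, ‖inner ℂ (f j) v‖ₑ ^ 2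
  upper : ∀ v ∈ V, ∑' j, ‖inner ℂ (f j) v‖ₑ ^ 2 ≤ ENNReal.ofReal (b * ‖v‖ ^ 2)

/-- A Parseval frame for `V` is a frame for `V` with both bounds equal to `1`. -/
def IsParsevalFrameFor {E J : Type*} [NormedAddCommGroup E] [InnerProductSpace ℂ E]
    (V : Submodule ℂ E) (f : J → E) : Prop :=
  IsFrameFor V f 1 1

/-! Write P for the periodization of φ. Plancherel's theorem turns translation by h into
multiplication by conj χ(h, ·). An element f of the span of the translates therefore satisfies f̂ =
m φ̂ with m a trigonometric polynomial, and m is H^⊥-periodic because every h lies in H. Folding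
over H^⊥ onto U_0 gives ‖f‖² = ∫_{U_0} |m|² P (`IsMultiplier.enorm_sq`). It also shows that the
numbers ⟨f, T_h φ⟩ are the Fourier coefficients of m P on U_0, so their squares sum to ∫_{U_0} |m|²
P² (`tsum_inner_translate`). Parseval's identity on the span thus compares P with P², and P = P²
with P finite means that P is the indicator of its own support.

If P = P² ≤ 1 a.e., the two integrals agree for every m, and the identity passes from the span to
its closure (`tsum_inner_eq_of_mem_closure`).

Conversely, P is a priori only integrable on U_0, so m P need not be square integrable; the bound P
≤ 1 has to come first. The upper frame bound says that the synthesis map has norm at most 1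
(`enorm_sum_smul_sq_le`). Tested on the coefficients of a Dirichlet kernel, whose multiplier on U_0
is the indicator of a ball, it gives ∫ P ≤ μ(ball) over each ball in U_0, hence P ≤ 1 a.e.
(`periodization_le_one`). Then the single function f = φ, m = 1 suffices: ∫ P = ∫ P² together with
P² ≤ P forces equality.

For the spectrum, the transforms of all elements of ⟨φ⟩ vanish where P does, while φ itself lies in
⟨φ⟩; so η(⟨φ⟩) ⊕ H^⊥ agrees with the support of P up to a null set (`ae_mem_spectrum_add_iff`).

Plancherel's theorem is obtained from characters cut off to balls: their span is dense, and the
Fourier transform maps such functions to scalar multiples of such functions. -/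

namespace Vilenkin

/-! ### Balls a + U_n, and measures and functions tested on them. -/

section
variable {p : ℕ} [NeZero p]

/-- The coset `a + U_n`, a ball for the topology of the Vilenkin group. -/
def coset (a : Vilenkin p) (n : ℤ) : Set (Vilenkin p) := {y | y - a ∈ U p n}

theorem mem_coset {a y : Vilenkin p} {n : ℤ} : y ∈ coset a n ↔ y - a ∈ U p n := Iff.rfl

theorem mem_coset_comm {a y : Vilenkin p} {n : ℤ} : y ∈ coset a n ↔ a ∈ coset y n := by
  rw [mem_coset, mem_coset, ← neg_sub, neg_mem_iff]

theorem self_mem_coset (a : Vilenkin p) (n : ℤ) : a ∈ coset a n := by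
  rw [mem_coset, sub_self]
  exact (U p n).zero_mem

theorem coset_eq_preimage (a : Vilenkin p) (n : ℤ) :
    coset a n = (fun x => x + -a) ⁻¹' (U p n : Set (Vilenkin p)) := by
  ext x
  simp [mem_coset, sub_eq_add_neg]

theorem measurableSet_coset (a : Vilenkin p) (n : ℤ) : MeasurableSet (coset a n) := by
  rw [coset_eq_preimage]
  exact (measurableSet_U _).preimage (measurable_add_const _)

theorem haar_coset (a : Vilenkin p) (n : ℤ) : haar p (coset a n) = haar p (U p n) := by
  rw [coset_eq_preimage, measure_preimage_add_right]

/-- A union of cosets of `U_n` is a countable disjoint union of such cosets. -/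
theorem exists_eq_iUnion_coset {E : Set (Vilenkin p)} {n : ℤ}
    (hE : ∀ a ∈ E, coset a n ⊆ E) :
    ∃ A : Set (Vilenkin p), A ⊆ E ∧ A.Countable ∧ E = ⋃ a : A, coset (a : Vilenkin p) n ∧
      Pairwise (Function.onFun Disjoint fun a : A => coset (a : Vilenkin p) n) := by
  have hout : ∀ x : Vilenkin p, x ∈ coset (Quotient.out (x : Vilenkin p ⧸ U p n)) n := by
    intro x
    have h : ((Quotient.out (x : Vilenkin p ⧸ U p n) : Vilenkin p) : Vilenkin p ⧸ U p n) = x :=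
      QuotientAddGroup.out_eq' _
    have := QuotientAddGroup.eq.1 h
    rwa [mem_coset, sub_eq_neg_add]
  refine ⟨(fun q : Vilenkin p ⧸ U p n => Quotient.out q) '' (QuotientAddGroup.mk '' E),
    ?_, (Set.to_countable _).image _, ?_, ?_⟩
  · rintro _ ⟨_, ⟨x, hx, rfl⟩, rfl⟩
    exact hE x hx (mem_coset_comm.1 (hout x))
  · ext x
    rw [Set.mem_iUnion]
    constructor
    · intro hx
      exact ⟨⟨_, _, ⟨x, hx, rfl⟩, rfl⟩, hout x⟩
    · rintro ⟨⟨_, _, ⟨y, hy, rfl⟩, rfl⟩, hx⟩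
      exact hE _ (hE y hy (mem_coset_comm.1 (hout y))) hx
  · rintro ⟨_, q, hq, rfl⟩ ⟨_, r, hr, rfl⟩ hne
    rw [Function.onFun, Set.disjoint_left]
    intro x hx hy
    apply hne
    have h1 : -Quotient.out q + Quotient.out r ∈ U p n := by
      have := (U p n).sub_mem hx hy
      rwa [sub_sub_sub_cancel_left, sub_eq_neg_add] at this
    have h2 := QuotientAddGroup.eq.2 h1
    rw [QuotientAddGroup.out_eq', QuotientAddGroup.out_eq'] at h2
    simp only [h2]

theorem setIntegral_eq_zero_of_coset {E : Set (Vilenkin p)} {n : ℤ}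
    (hE : ∀ a ∈ E, coset a n ⊆ E) {g : Vilenkin p → ℂ} (hg : IntegrableOn g E (haar p))
    (h0 : ∀ a ∈ E, ∫ x in coset a n, g x ∂(haar p) = 0) :
    ∫ x in E, g x ∂(haar p) = 0 := by
  obtain ⟨A, hAE, hA, hU, hd⟩ := exists_eq_iUnion_coset hE
  have := hA.to_subtype
  rw [hU] at hg ⊢
  rw [integral_iUnion (fun a => measurableSet_coset _ _) hd hg]
  simp [fun a : A => h0 a (hAE a.2)]

theorem measure_le_of_coset {E : Set (Vilenkin p)} {n : ℤ}
    (hE : ∀ a ∈ E, coset a n ⊆ E) {ν ρ : Measure (Vilenkin p)}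
    (h : ∀ a, ν (coset a n) ≤ ρ (coset a n)) : ν E ≤ ρ E := by
  obtain ⟨A, hAE, hA, hU, hd⟩ := exists_eq_iUnion_coset hE
  have := hA.to_subtype
  rw [hU, measure_iUnion hd fun a => measurableSet_coset _ _,
    measure_iUnion hd fun a => measurableSet_coset _ _]
  exact ENNReal.tsum_le_tsum fun a => h a

theorem coset_anti (a : Vilenkin p) : Antitone (coset a) := fun _ _ h _ hx => U_anti p h hx

theorem coset_subset_coset {a b : Vilenkin p} {n : ℤ} (h : b ∈ coset a n) :
    coset b n ⊆ coset a n := by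
  intro x hx
  have := (U p n).add_mem hx h
  rwa [sub_add_sub_cancel] at this

/-- A measure dominated by an outer regular one on small balls is dominated by it. -/
theorem measure_le_of_forall_coset {ν ρ : Measure (Vilenkin p)} [ρ.OuterRegular]
    (h : ∀ (n : ℕ) a, ν (coset a n) ≤ ρ (coset a n)) : ν ≤ ρ := by
  have hopen : ∀ O : Set (Vilenkin p), IsOpen O → ν O ≤ ρ O := by
    intro O hO
    -- O is exhausted by the increasing sets of points whose ball of index n stays inside O. Each of
    -- these is a union of balls of index n, so the comparison on balls applies to it.
    have hU : O = ⋃ n : ℕ, {x | coset x n ⊆ O} := by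
      ext x
      rw [Set.mem_iUnion]
      constructor
      · intro hx
        obtain ⟨l, -, hl⟩ := (nhds_hasBasis x).mem_iff.1 (hO.mem_nhds hx)
        exact ⟨l.toNat, (coset_anti x (Int.self_le_toNat l)).trans hl⟩
      · rintro ⟨n, hn⟩
        exact hn (self_mem_coset x n)
    have hmono : Monotone fun n : ℕ => {x : Vilenkin p | coset x n ⊆ O} :=
      fun m n hmn x hx => (coset_anti x (Int.ofNat_le.2 hmn)).trans hx
    rw [hU, hmono.measure_iUnion, hmono.measure_iUnion]
    exact iSup_mono fun n => measure_le_of_coset (n := n)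
      (fun a ha x hx => (coset_subset_coset hx).trans ha) (h n)
  refine Measure.le_iff.2 fun s _ => ?_
  rw [s.measure_eq_iInf_isOpen ρ]
  exact le_iInf fun O => le_iInf fun hs => le_iInf fun hO => (measure_mono hs).trans (hopen O hO)

instance : (haar p).Regular := inferInstanceAs (Measure.addHaarMeasure (unitCompact p)).Regular

theorem integrableOn_of_memLp {f : Vilenkin p → ℂ} (hf : MemLp f 2 (haar p)) (l : ℤ) :
    IntegrableOn f (U p l : Set (Vilenkin p)) (haar p) := by
  have : IsFiniteMeasure ((haar p).restrict (U p l : Set (Vilenkin p))) :=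
    ⟨by simpa using haar_U_lt_top l⟩
  exact (hf.restrict _).integrable (by norm_num)

/-- A square integrable function whose integrals over all balls vanish is zero. -/
theorem ae_eq_zero_of_forall_coset {g : Vilenkin p → ℂ} (hg : MemLp g 2 (haar p))
    (h0 : ∀ a (n : ℤ), ∫ x in coset a n, g x ∂(haar p) = 0) : g =ᵐ[haar p] 0 := by
  have key : ∀ l : ℤ, (U p l : Set (Vilenkin p)).indicator g =ᵐ[haar p] 0 := by
    intro l
    have hint : Integrable ((U p l : Set (Vilenkin p)).indicator g) (haar p) :=
      (integrable_indicator_iff (measurableSet_U l)).2 (integrableOn_of_memLp hg l)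
    refine ae_eq_zero_of_forall_setIntegral_isClosed_eq_zero hint fun C hC => ?_
    -- The neighbourhoods D n decrease to the closed set C. The shift by `l.toNat` keeps the index
    -- at least l, so that the intersection of D n with U_l is still a union of balls.
    let D : ℕ → Set (Vilenkin p) := fun n => ⋃ c ∈ C, coset c ((n : ℤ) + l.toNat)
    have hDsat : ∀ n, ∀ a ∈ D n, coset a ((n : ℤ) + l.toNat) ⊆ D n := by
      intro n a ha
      obtain ⟨c, hc, hac⟩ := Set.mem_iUnion₂.1 ha
      exact (coset_subset_coset hac).trans (Set.subset_biUnion_of_mem (u := fun c =>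
        coset c ((n : ℤ) + l.toNat)) hc)
    have hDm : ∀ n, MeasurableSet (D n) := by
      intro n
      obtain ⟨A, -, hA, hU, -⟩ := exists_eq_iUnion_coset (hDsat n)
      have := hA.to_subtype
      rw [hU]
      exact MeasurableSet.iUnion fun a => measurableSet_coset _ _
    have hanti : Antitone D := fun m n hmn =>
      Set.iUnion₂_mono fun c _ => coset_anti c (by omega)
    have hInter : C = ⋂ n, D n := by
      refine Set.Subset.antisymm (Set.subset_iInter fun n c hc =>
        Set.mem_iUnion₂.2 ⟨c, hc, self_mem_coset c _⟩) fun x hx => ?_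
      rw [← hC.closure_eq, mem_closure_iff_nhds_basis (nhds_hasBasis x)]
      intro i _
      obtain ⟨c, hc, hxc⟩ := Set.mem_iUnion₂.1 (Set.mem_iInter.1 hx i.toNat)
      exact ⟨c, hc, coset_anti x (by omega) (mem_coset_comm.1 hxc)⟩
    have hlim := tendsto_setIntegral_of_antitone hDm hanti ⟨0, hint.integrableOn⟩
    rw [← hInter] at hlim
    refine tendsto_nhds_unique hlim (tendsto_const_nhds.congr fun n => ?_)
    rw [setIntegral_indicator (measurableSet_U l)]
    refine (setIntegral_eq_zero_of_coset (n := (n : ℤ) + l.toNat) ?_ ?_ fun a _ => h0 a _).symm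
    · rintro a ⟨ha, hl⟩
      refine Set.subset_inter (hDsat n a ha) fun x hx => ?_
      have := (U p l).add_mem (U_anti p (by omega) hx) hl
      rwa [sub_add_cancel] at this
    · exact (integrableOn_of_memLp hg l).mono_set Set.inter_subset_right
  have hall := ae_all_iff.2 fun n : ℕ => key (-n)
  filter_upwards [hall] with x hx
  obtain ⟨l, hl⟩ := exists_mem_U x
  have := hx l.natAbs
  rwa [Set.indicator_of_mem] at this
  exact U_anti p (by omega) hl

/-! ### Characters on balls, Fourier inversion and Plancherel. -/

/-- The function `1_{a + U_n} χ(·, b)`. -/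
noncomputable def wave (a : Vilenkin p) (n : ℤ) (b : Vilenkin p) : Vilenkin p → ℂ :=
  (coset a n).indicator fun x => chi x b

theorem memLp_wave (a : Vilenkin p) (n : ℤ) (b : Vilenkin p) : MemLp (wave a n b) 2 (haar p) := by
  have : IsFiniteMeasure ((haar p).restrict (coset a n)) :=
    ⟨by simpa [haar_coset] using haar_U_lt_top n⟩
  rw [wave, memLp_indicator_iff_restrict (measurableSet_coset a n)]
  exact MemLp.of_bound (continuous_chi b).aestronglyMeasurable 1
    (Eventually.of_forall fun x => (norm_chi x b).le)

/-- `wave a n b` as an element of `L²`. -/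
noncomputable def waveLp (a : Vilenkin p) (n : ℤ) (b : Vilenkin p) : L2 p :=
  (memLp_wave a n b).toLp

theorem inner_waveLp_zero (a : Vilenkin p) (n : ℤ) (g : L2 p) :
    inner ℂ (waveLp a n 0) g = ∫ x in coset a n, g x ∂(haar p) := by
  rw [L2.inner_def, ← integral_indicator (measurableSet_coset a n)]
  refine integral_congr_ae ?_
  filter_upwards [(memLp_wave a n 0).coeFn_toLp] with x hx
  rw [waveLp, hx, wave]
  by_cases h : x ∈ coset a n
  · rw [Set.indicator_of_mem h, Set.indicator_of_mem h, RCLike.inner_apply, chi_zero_right]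
    simp
  · rw [Set.indicator_of_notMem h, Set.indicator_of_notMem h, inner_zero_left]

/-- The span of the functions `1_{a + U_n} χ(·, b)` is dense in `L²`. -/
theorem dense_span_waveLp :
    Dense (Submodule.span ℂ (Set.range fun q : Vilenkin p × ℤ × Vilenkin p =>
      waveLp q.1 q.2.1 q.2.2) : Set (L2 p)) := by
  rw [Submodule.dense_iff_topologicalClosure_eq_top, Submodule.topologicalClosure_eq_top_iff,
    Submodule.eq_bot_iff]
  intro g hg
  rw [Lp.eq_zero_iff_ae_eq_zero]
  refine ae_eq_zero_of_forall_coset (Lp.memLp g) fun a n => ?_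
  rw [← inner_waveLp_zero]
  -- Indicators of balls, the case b = 0, already have dense span; general b is there to make the
  -- family stable under the Fourier transform.
  exact (Submodule.mem_orthogonal _ _).1 hg _ (Submodule.subset_span ⟨(a, n, 0), rfl⟩)

/-- The substitution j ↦ 1 - j exchanges the two arguments. The group is thereby its own dual in a
symmetric way, and the Fourier transform can be iterated. -/
theorem chi_comm (x ω : Vilenkin p) : chi x ω = chi ω x := by
  rw [chi, chi, ← finsum_comp_equiv (Equiv.subLeft (1 : ℤ))]
  congr 1
  refine finsum_congr fun j => ?_
  simp [mul_comm]

theorem chi_zero_left (x : Vilenkin p) : chi 0 x = 1 := by rw [chi_comm, chi_zero_right]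

theorem chi_neg_left (x ω : Vilenkin p) : chi (-x) ω = (starRingEnd ℂ) (chi x ω) := by
  rw [chi_comm, chi_neg_right, chi_comm]

theorem integral_chi_eq (n : ℤ) (ω : Vilenkin p) :
    ∫ x in (U p n : Set (Vilenkin p)), chi x ω ∂(haar p) =
      (U p (-n) : Set (Vilenkin p)).indicator (fun _ => ((haar p).real (U p n) : ℂ)) ω := by
  by_cases h : ω ∈ (U p (-n) : Set (Vilenkin p))
  · rw [Set.indicator_of_mem h, setIntegral_congr_fun (g := fun _ => (1 : ℂ)) (measurableSet_U n)
      fun x hx => chi_eq_one hx h]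
    simp
  · rw [Set.indicator_of_notMem h, integral_chi h]

theorem setIntegral_coset (a : Vilenkin p) (n : ℤ) (g : Vilenkin p → ℂ) :
    ∫ x in coset a n, g x ∂(haar p) = ∫ x in (U p n : Set (Vilenkin p)), g (x + a) ∂(haar p) := by
  rw [← integral_indicator (measurableSet_coset a n), ← integral_indicator (measurableSet_U n),
    ← integral_add_right_eq_self _ a]
  congr 1
  ext x
  by_cases h : x ∈ U p n
  · rw [Set.indicator_of_mem (by simpa [mem_coset] using h), Set.indicator_of_mem (by exact h)]
  · rw [Set.indicator_of_notMem (by simpa [mem_coset] using h),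
      Set.indicator_of_notMem (by exact h)]

theorem truncFourier_congr {l : ℤ} {f g : Vilenkin p → ℂ} (h : f =ᵐ[haar p] g) :
    truncFourier l f = truncFourier l g := by
  ext ω
  refine integral_congr_ae ?_
  filter_upwards [ae_restrict_of_ae h] with x hx
  rw [hx]

/-- The hypotheses put the ball a + U_n inside U_l, so truncation loses nothing. After translation
by a, the integral of the character b - ω over U_n is μ(U_n) or 0 according to whether ω lies in b +
U_{-n}. -/
theorem truncFourier_wave {l n : ℤ} {a b : Vilenkin p} (hl : l ≤ n) (ha : a ∈ U p l) :
    truncFourier l (wave a n b) =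
      fun ω => (((haar p).real (U p n) : ℂ) * chi a b) * wave b (-n) (-a) ω := by
  ext ω
  have hsub : coset a n ⊆ (U p l : Set (Vilenkin p)) := fun x hx => by
    have := (U p l).add_mem (U_anti p hl hx) ha
    rwa [sub_add_cancel] at this
  have h1 : truncFourier l (wave a n b) ω = ∫ x in coset a n, chi x (b - ω) ∂(haar p) := by
    rw [← Set.inter_eq_self_of_subset_right hsub,
      ← setIntegral_indicator (measurableSet_coset a n), truncFourier]
    congr 1
    ext x
    by_cases hx : x ∈ coset a n
    · rw [wave, Set.indicator_of_mem hx, Set.indicator_of_mem hx, sub_eq_add_neg, chi_add_right,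
        chi_neg_right]
    · rw [wave, Set.indicator_of_notMem hx, Set.indicator_of_notMem hx, zero_mul]
  have h2 : ∀ x, chi (x + a) (b - ω) = chi x (b - ω) * chi a (b - ω) := fun x =>
    chi_add_left _ _ _
  rw [h1, setIntegral_coset]
  simp_rw [h2]
  rw [integral_mul_const, integral_chi_eq]
  by_cases h : b - ω ∈ (U p (-n) : Set (Vilenkin p))
  · have h' : ω ∈ coset b (-n) := mem_coset_comm.1 h
    rw [Set.indicator_of_mem h, wave, Set.indicator_of_mem h', chi_neg_right, chi_comm ω a,
      sub_eq_add_neg, chi_add_right, chi_neg_right, mul_assoc]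
  · have h' : ω ∉ coset b (-n) := fun h' => h (mem_coset_comm.1 h')
    rw [Set.indicator_of_notMem h, wave, Set.indicator_of_notMem h', zero_mul, mul_zero]

theorem fourier_eq_of_forall {f g : L2 p} {l : ℤ}
    (h : ∀ m ≤ l, truncFourier m f =ᵐ[haar p] g) : fourier f = g := by
  refine tendsto_nhds_unique (tendsto_fourier f) (tendsto_const_nhds.congr' ?_)
  filter_upwards [eventually_ge_atTop l.natAbs] with n hn
  refine (Lp.ext ?_).symm
  rw [truncFourierLp]
  exact (memLp_truncFourier _ _).coeFn_toLp.trans (h _ (by omega))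

theorem fourier_waveLp (a : Vilenkin p) (n : ℤ) (b : Vilenkin p) :
    fourier (waveLp a n b) = (((haar p).real (U p n) : ℂ) * chi a b) • waveLp b (-n) (-a) := by
  obtain ⟨k, hk⟩ := exists_mem_U a
  refine fourier_eq_of_forall (l := min k n) fun m hm => ?_
  rw [waveLp, truncFourier_congr (memLp_wave a n b).coeFn_toLp,
    truncFourier_wave (hm.trans (min_le_right _ _)) (U_anti p (hm.trans (min_le_left _ _)) hk)]
  filter_upwards [Lp.coeFn_smul (((haar p).real (U p n) : ℂ) * chi a b) (waveLp b (-n) (-a)),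
    (memLp_wave b (-n) (-a)).coeFn_toLp] with x h1 h2
  rw [h1, Pi.smul_apply, waveLp, h2, smul_eq_mul]

theorem truncFourierLp_add (l : ℤ) (f g : L2 p) :
    truncFourierLp l (f + g) = truncFourierLp l f + truncFourierLp l g := by
  rw [truncFourierLp, truncFourierLp, truncFourierLp, ← MemLp.toLp_add]
  refine MemLp.toLp_congr _ _ (Eventually.of_forall fun ω => ?_)
  rw [Pi.add_apply, ← inner_charLp, ← inner_charLp, ← inner_charLp, inner_add_right]

theorem truncFourierLp_smul (l : ℤ) (c : ℂ) (f : L2 p) :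
    truncFourierLp l (c • f) = c • truncFourierLp l f := by
  rw [truncFourierLp, truncFourierLp, ← MemLp.toLp_const_smul]
  refine MemLp.toLp_congr _ _ (Eventually.of_forall fun ω => ?_)
  rw [Pi.smul_apply, ← inner_charLp, ← inner_charLp, inner_smul_right, smul_eq_mul]

theorem fourier_add (f g : L2 p) : fourier (f + g) = fourier f + fourier g := by
  refine tendsto_nhds_unique (tendsto_fourier _) ?_
  simp_rw [truncFourierLp_add]
  exact (tendsto_fourier f).add (tendsto_fourier g)

theorem fourier_smul (c : ℂ) (f : L2 p) : fourier (c • f) = c • fourier f := by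
  refine tendsto_nhds_unique (tendsto_fourier _) ?_
  simp_rw [truncFourierLp_smul]
  exact (tendsto_fourier f).const_smul c

/-- The Fourier transform as a continuous linear map. -/
noncomputable def fourierCLM (p : ℕ) [NeZero p] : L2 p →L[ℂ] L2 p where
  toFun := fourier
  map_add' := fourier_add
  map_smul' := fourier_smul
  cont := continuous_fourier

theorem fourierCLM_apply (f : L2 p) : fourierCLM p f = fourier f := rfl

/-- The reflection `f ↦ f(-x)`. -/
noncomputable def reflection (p : ℕ) [NeZero p] : L2 p →ₗᵢ[ℂ] L2 p :=
  Lp.compMeasurePreservingₗᵢ ℂ (fun x => -x) (Measure.measurePreserving_neg (haar p))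

theorem reflection_waveLp (a : Vilenkin p) (n : ℤ) (b : Vilenkin p) :
    reflection p (waveLp a n b) = waveLp (-a) n (-b) := by
  refine Lp.ext ?_
  have hmp := Measure.measurePreserving_neg (haar p)
  filter_upwards [Lp.coeFn_compMeasurePreserving (waveLp a n b) hmp,
    hmp.quasiMeasurePreserving.tendsto_ae.eventually (memLp_wave a n b).coeFn_toLp,
    (memLp_wave (-a) n (-b)).coeFn_toLp] with x h1 h2 h3
  refine Eq.trans ?_ h3.symm
  refine h1.trans (h2.trans ?_)
  have hiff : -x ∈ coset a n ↔ x ∈ coset (-a) n := by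
    rw [mem_coset, mem_coset, ← neg_mem_iff]
    simp [add_comm, sub_eq_add_neg]
  by_cases h : x ∈ coset (-a) n
  · rw [wave, wave, Set.indicator_of_mem h, Set.indicator_of_mem (hiff.2 h), chi_neg_left,
      chi_neg_right]
  · rw [wave, wave, Set.indicator_of_notMem h, Set.indicator_of_notMem fun h' => h (hiff.1 h')]

/-- Fourier inversion. -/
theorem fourier_fourier (f : L2 p) : fourier (fourier f) = reflection p f := by
  have h : (fourierCLM p).comp (fourierCLM p) = (reflection p).toContinuousLinearMap := by
    -- Both sides are continuous and linear. On waves the two scalars produced by transforming twice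
    -- cancel: μ(U_n) μ(U_{-n}) = 1 and χ(a, b) χ(b, -a) = 1.
    refine ContinuousLinearMap.ext_on dense_span_waveLp ?_
    rintro _ ⟨⟨a, n, b⟩, rfl⟩
    change fourier (fourier (waveLp a n b)) = reflection p (waveLp a n b)
    rw [fourier_waveLp, fourier_smul, fourier_waveLp, reflection_waveLp, neg_neg, smul_smul]
    have h1 : ((haar p).real (U p n) : ℂ) * (haar p).real (U p (-n)) = 1 := by
      rw [← Complex.ofReal_mul, Measure.real, Measure.real, ← ENNReal.toReal_mul, haar_U_mul]
      simp
    have h2 : chi a b * chi b (-a) = 1 := by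
      rw [chi_comm b, ← chi_add_left, add_neg_cancel, chi_zero_left]
    have h3 : ((haar p).real (U p n) : ℂ) * chi a b * ((haar p).real (U p (-n)) * chi b (-a)) =
        1 := by
      rw [mul_mul_mul_comm, h1, h2, one_mul]
    rw [h3, one_smul]
  exact DFunLike.congr_fun h f

theorem norm_fourier_le (f : L2 p) : ‖fourier f‖ ≤ ‖f‖ := by
  have h0 : fourier (0 : L2 p) = 0 := map_zero (fourierCLM p)
  simpa [h0] using dist_fourier_le f 0

/-- Plancherel's theorem. -/
theorem norm_fourier (f : L2 p) : ‖fourier f‖ = ‖f‖ := by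
  refine (norm_fourier_le f).antisymm ?_
  -- A contraction whose square is an isometry is itself an isometry.
  calc ‖f‖ = ‖fourier (fourier f)‖ := by rw [fourier_fourier, LinearIsometry.norm_map]
    _ ≤ ‖fourier f‖ := norm_fourier_le _

theorem inner_fourier (f g : L2 p) : inner ℂ (fourier f) (fourier g) = inner ℂ f g :=
  LinearIsometry.inner_map_map
    (⟨(fourierCLM p).toLinearMap, norm_fourier⟩ : L2 p →ₗᵢ[ℂ] L2 p) f g

/-! ### Folding over H^⊥ and the periodization. -/

theorem H_eq_Hperp : H p = Hperp p := by
  ext x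
  rw [mem_Hperp, mem_H]

instance : Countable (Hperp p) := countable_Hperp

/-- The part of `x` with indices `j ≤ 0`, an element of `H^⊥`. -/
noncomputable def lowPart (x : Vilenkin p) : Hperp p :=
  ⟨⟨fun j => if j ≤ 0 then x j else 0, by
    obtain ⟨k, hk⟩ := x.2
    exact ⟨k, fun j hj => by
      simp [hk j hj]⟩⟩, mem_Hperp.2 fun _ hj => if_neg (not_le.2 hj)⟩

theorem lowPart_apply (x : Vilenkin p) (j : ℤ) :
    (lowPart x : Vilenkin p) j = if j ≤ 0 then x j else 0 := rfl

theorem sub_lowPart_mem (x : Vilenkin p) : x - lowPart x ∈ U p 0 := by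
  intro j hj
  rw [sub_apply, lowPart_apply, if_pos hj, sub_self]

theorem eq_of_add_mem_U {x : Vilenkin p} {k l : Hperp p} (hk : x + k ∈ U p 0)
    (hl : x + l ∈ U p 0) : k = l := by
  refine Subtype.ext (ext fun j => ?_)
  rcases le_or_gt j 0 with hj | hj
  · have h1 := hk j hj
    have h2 := hl j hj
    rw [add_apply] at h1 h2
    exact add_left_cancel (h1.trans h2.symm)
  · rw [mem_Hperp.1 k.2 j hj, mem_Hperp.1 l.2 j hj]

theorem exists_add_mem_U (x : Vilenkin p) : ∃ k : Hperp p, x + k ∈ U p 0 :=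
  ⟨-lowPart x, by simpa [sub_eq_add_neg] using sub_lowPart_mem x⟩

/-- Each x splits uniquely into its entries of index at most 0, an element of H^⊥, and its entries
of positive index, an element of U_0. -/
theorem isAddFundamentalDomain_U :
    IsAddFundamentalDomain (Hperp p) (U p 0 : Set (Vilenkin p)) (haar p) := by
  refine IsAddFundamentalDomain.mk' (measurableSet_U 0).nullMeasurableSet fun x => ?_
  obtain ⟨k, hk⟩ := exists_add_mem_U x
  refine ⟨k, ?_, fun l hl => ?_⟩
  · change (k : Vilenkin p) + x ∈ U p 0
    rwa [add_comm]
  · change (l : Vilenkin p) + x ∈ U p 0 at hl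
    rw [add_comm] at hl
    exact eq_of_add_mem_U hl hk

theorem quasiMeasurePreserving_add (k : Vilenkin p) :
    Measure.QuasiMeasurePreserving (fun x => x + k) (haar p) (haar p) :=
  (measurePreserving_add_right (haar p) k).quasiMeasurePreserving

theorem ae_forall_add {Q : Vilenkin p → Prop} (h : ∀ᵐ ω ∂(haar p), Q ω) :
    ∀ᵐ ω ∂(haar p), ∀ k : Hperp p, Q (ω + k) := by
  rw [ae_all_iff]
  intro k
  filter_upwards [(quasiMeasurePreserving_add (k : Vilenkin p)).tendsto_ae.eventually h]
    with ω hω using hω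

theorem ae_of_ae_U {Q : Vilenkin p → Prop} (hQ : ∀ ω (k : Hperp p), Q (ω + k) → Q ω)
    (h : ∀ᵐ ω ∂(haar p), ω ∈ U p 0 → Q ω) : ∀ᵐ ω ∂(haar p), Q ω := by
  filter_upwards [ae_forall_add h] with ω hω
  obtain ⟨k, hk⟩ := exists_add_mem_U ω
  exact hQ ω k (hω k hk)

theorem lintegral_eq_lintegral_tsum {G : Vilenkin p → ℝ≥0∞} (hG : AEMeasurable G (haar p)) :
    ∫⁻ ω, G ω ∂(haar p) =
      ∫⁻ ω in (U p 0 : Set (Vilenkin p)), ∑' k : Hperp p, G (ω + k) ∂(haar p) := by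
  have hm : ∀ k : Hperp p, AEMeasurable (fun ω => G (ω + k)) (haar p) := fun k =>
    hG.comp_quasiMeasurePreserving (quasiMeasurePreserving_add (k : Vilenkin p))
  rw [lintegral_tsum fun k => (hm k).restrict, isAddFundamentalDomain_U.lintegral_eq_tsum'']
  refine tsum_congr fun k => ?_
  congr 1
  ext ω
  rw [add_comm]
  rfl

theorem integral_eq_integral_tsum {G : Vilenkin p → ℂ} (hG : Integrable G (haar p)) :
    ∫ ω, G ω ∂(haar p) =
      ∫ ω in (U p 0 : Set (Vilenkin p)), ∑' k : Hperp p, G (ω + k) ∂(haar p) := by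
  have hm : ∀ k : Hperp p, AEStronglyMeasurable (fun ω => G (ω + k)) (haar p) := fun k =>
    hG.1.comp_quasiMeasurePreserving (quasiMeasurePreserving_add (k : Vilenkin p))
  rw [integral_tsum (fun k => (hm k).restrict), isAddFundamentalDomain_U.integral_eq_tsum'' _ hG]
  · refine tsum_congr fun k => ?_
    congr 1
    ext ω
    rw [add_comm]
    rfl
  · rw [← lintegral_tsum fun k => (hm k).enorm.restrict,
      ← lintegral_eq_lintegral_tsum hG.1.enorm]
    exact hG.2.ne

theorem enorm_sq_eq_lintegral (f : L2 p) : ‖f‖ₑ ^ 2 = ∫⁻ x, ‖f x‖ₑ ^ 2 ∂(haar p) := by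
  rw [Lp.enorm_def, eLpNorm_eq_lintegral_rpow_enorm_toReal (by simp) (by simp)]
  simp only [ENNReal.toReal_ofNat, ENNReal.rpow_ofNat]
  rw [← ENNReal.rpow_natCast, ← ENNReal.rpow_mul]
  simp

theorem aemeasurable_periodization (φ : L2 p) : AEMeasurable (periodization φ) (haar p) :=
  AEMeasurable.tsum fun k : Hperp p =>
    ((Lp.aestronglyMeasurable (fourier φ)).comp_quasiMeasurePreserving
      (quasiMeasurePreserving_add (k : Vilenkin p))).enorm.pow_const 2

theorem periodization_add (φ : L2 p) (ω : Vilenkin p) (k : Hperp p) :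
    periodization φ (ω + k) = periodization φ ω := by
  rw [periodization, periodization,
    ← (Equiv.addLeft k).tsum_eq fun h : Hperp p => ‖fourier φ (ω + h)‖ₑ ^ 2]
  exact tsum_congr fun h => by simp [add_assoc]

theorem enorm_fourier (f : L2 p) : ‖fourier f‖ₑ = ‖f‖ₑ := by
  rw [← ofReal_norm, ← ofReal_norm, norm_fourier]

theorem lintegral_periodization (φ : L2 p) :
    ∫⁻ ω in (U p 0 : Set (Vilenkin p)), periodization φ ω ∂(haar p) = ‖φ‖ₑ ^ 2 := by
  rw [← enorm_fourier, enorm_sq_eq_lintegral,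
    lintegral_eq_lintegral_tsum ((Lp.aestronglyMeasurable (fourier φ)).enorm.pow_const 2)]
  rfl

/-- Parseval's identity for functions supported in `U_0`. -/
theorem tsum_truncFourier_zero {g : L2 p} (hg : ∀ᵐ x ∂(haar p), x ∉ U p 0 → g x = 0) :
    ∑' k : Hperp p, ‖truncFourier 0 g k‖ₑ ^ 2 = ‖g‖ₑ ^ 2 := by
  have hF : fourier g = truncFourierLp 0 g := by
    -- Since g vanishes off U_0, the truncated integrals stop changing once the domain contains U_0.
    refine fourier_eq_of_forall (l := 0) fun m hm => ?_
    refine EventuallyEq.trans (Eventually.of_forall fun ω => ?_)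
      (memLp_truncFourier 0 g).coeFn_toLp.symm
    rw [truncFourier, truncFourier, ← integral_indicator (measurableSet_U m),
      ← integral_indicator (measurableSet_U 0)]
    refine integral_congr_ae ?_
    filter_upwards [hg] with x hx
    by_cases h : x ∈ (U p 0 : Set (Vilenkin p))
    · rw [Set.indicator_of_mem h, Set.indicator_of_mem (U_anti p hm h)]
    · rw [Set.indicator_of_notMem h, Set.indicator_apply_eq_zero]
      intro _
      rw [hx h, zero_mul]
  have hm : AEMeasurable (fun ω => ‖truncFourier 0 g ω‖ₑ ^ 2) (haar p) :=
    (continuous_truncFourier 0 g).aestronglyMeasurable.enorm.pow_const 2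
  have h1 : ‖g‖ₑ ^ 2 = ∫⁻ ω, ‖truncFourier 0 g ω‖ₑ ^ 2 ∂(haar p) := by
    rw [← enorm_fourier, enorm_sq_eq_lintegral, hF]
    refine lintegral_congr_ae ?_
    filter_upwards [(memLp_truncFourier 0 g).coeFn_toLp] with ω hω
    rw [truncFourierLp, hω]
  rw [h1, lintegral_eq_lintegral_tsum hm, setLIntegral_congr_fun (measurableSet_U 0)
    (g := fun _ => ∑' k : Hperp p, ‖truncFourier 0 g k‖ₑ ^ 2) fun ω hω => ?_]
  · rw [setLIntegral_const, haar_U_zero, mul_one]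
  -- A transform truncated to U_0 is U_0-periodic, so the folded integrand is constant on U_0, a set
  -- of measure 1.
  · refine tsum_congr fun k => ?_
    rw [add_comm, truncFourier_add_mem _ _ (by simpa using hω)]

/-! ### Translations as modulations, and periodic multipliers. -/

theorem memLp_chi_mul (h : Vilenkin p) (f : L2 p) :
    MemLp (fun ω => (starRingEnd ℂ) (chi h ω) * f ω) 2 (haar p) := by
  refine (Lp.memLp f).of_le ?_ (Eventually.of_forall fun ω => ?_)
  · have : Continuous fun ω => chi h ω := by
      simp_rw [chi_comm h]
      exact continuous_chi h
    exact (Complex.continuous_conj.comp this).aestronglyMeasurable.mul (Lp.aestronglyMeasurable f)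
  · rw [norm_mul, RCLike.norm_conj, norm_chi, one_mul]

/-- Multiplication by the character `conj χ(h, ·)`. -/
noncomputable def modulate (h : Vilenkin p) (f : L2 p) : L2 p := (memLp_chi_mul h f).toLp

theorem isometry_modulate (h : Vilenkin p) : Isometry (modulate (p := p) h) := by
  intro f g
  rw [modulate, modulate, Lp.edist_toLp_toLp, Lp.edist_def]
  refine eLpNorm_congr_norm_ae (Eventually.of_forall fun ω => ?_)
  rw [Pi.sub_apply, Pi.sub_apply, ← mul_sub, norm_mul, RCLike.norm_conj, norm_chi, one_mul]

theorem coeFn_translate (h : Vilenkin p) (φ : L2 p) :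
    translate h φ =ᵐ[haar p] fun x => φ (x - h) :=
  Lp.coeFn_compMeasurePreserving φ (measurePreserving_sub_right (haar p) h)

theorem truncFourier_translate {l : ℤ} {h : Vilenkin p} (hh : h ∈ U p l) (φ : L2 p)
    (ω : Vilenkin p) :
    truncFourier l (translate h φ) ω = (starRingEnd ℂ) (chi h ω) * truncFourier l φ ω := by
  rw [truncFourier_congr (coeFn_translate h φ), truncFourier, truncFourier,
    ← integral_indicator (measurableSet_U l), ← integral_indicator (measurableSet_U l),
    ← integral_add_right_eq_self _ h, ← integral_const_mul]
  congr 1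
  ext x
  have hiff : x + h ∈ (U p l : Set (Vilenkin p)) ↔ x ∈ (U p l : Set (Vilenkin p)) :=
    AddSubgroup.add_mem_cancel_right _ hh
  by_cases hx : x ∈ (U p l : Set (Vilenkin p))
  · rw [Set.indicator_of_mem hx, Set.indicator_of_mem (hiff.2 hx), add_sub_cancel_right,
      chi_add_left, map_mul]
    ring
  · rw [Set.indicator_of_notMem hx, Set.indicator_of_notMem fun h' => hx (hiff.1 h'), mul_zero]

/-- The identity is exact for the truncated transforms as soon as U_{-n} contains h, since U_{-n} is
then invariant under translation by h. Modulation is an isometry, so the identity survives the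
limit. -/
theorem fourier_translate (h : Vilenkin p) (φ : L2 p) :
    fourier (translate h φ) = modulate h (fourier φ) := by
  refine tendsto_nhds_unique (tendsto_fourier _)
    ((((isometry_modulate h).continuous.tendsto _).comp (tendsto_fourier φ)).congr' ?_)
  obtain ⟨l, hl⟩ := exists_mem_U h
  filter_upwards [eventually_ge_atTop l.natAbs] with n hn
  refine Lp.ext ?_
  filter_upwards [(memLp_chi_mul h (truncFourierLp (-n) φ)).coeFn_toLp,
    (memLp_truncFourier (-n) φ).coeFn_toLp, (memLp_truncFourier (-n) (translate h φ)).coeFn_toLp]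
    with ω h1 h2 h3
  rw [Function.comp_apply, modulate, h1, truncFourierLp, h2, truncFourierLp, h3,
    truncFourier_translate (U_anti p (by omega) hl)]

/-- `m` is a multiplier carrying `φ` to `f`: `f̂ = m φ̂` almost everywhere. -/
def IsMultiplier (φ : L2 p) (m : Vilenkin p → ℂ) (f : L2 p) : Prop :=
  fourier f =ᵐ[haar p] fun ω => m ω * fourier φ ω

theorem isMultiplier_translate (h : Vilenkin p) (φ : L2 p) :
    IsMultiplier φ (fun ω => (starRingEnd ℂ) (chi h ω)) (translate h φ) := by
  rw [IsMultiplier, fourier_translate]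
  exact (memLp_chi_mul h (fourier φ)).coeFn_toLp

theorem isMultiplier_self (φ : L2 p) : IsMultiplier φ (fun _ => 1) φ :=
  Eventually.of_forall fun _ => (one_mul _).symm

theorem isMultiplier_zero (φ : L2 p) : IsMultiplier φ (fun _ => 0) 0 := by
  rw [IsMultiplier, ← fourierCLM_apply, map_zero]
  filter_upwards [Lp.coeFn_zero ℂ 2 (haar p)] with ω hω
  rw [hω, zero_mul, Pi.zero_apply]

theorem IsMultiplier.add {φ f g : L2 p} {m n : Vilenkin p → ℂ} (hf : IsMultiplier φ m f)
    (hg : IsMultiplier φ n g) : IsMultiplier φ (fun ω => m ω + n ω) (f + g) := by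
  rw [IsMultiplier, fourier_add]
  filter_upwards [Lp.coeFn_add (fourier f) (fourier g), hf, hg] with ω h1 h2 h3
  rw [h1, Pi.add_apply, h2, h3, add_mul]

theorem IsMultiplier.smul {φ f : L2 p} {m : Vilenkin p → ℂ} (hf : IsMultiplier φ m f) (c : ℂ) :
    IsMultiplier φ (fun ω => c * m ω) (c • f) := by
  rw [IsMultiplier, fourier_smul]
  filter_upwards [Lp.coeFn_smul c (fourier f), hf] with ω h1 h2
  rw [h1, Pi.smul_apply, h2, smul_eq_mul, mul_assoc]

theorem IsMultiplier.sum {ι : Type*} {φ : L2 p} {m : ι → Vilenkin p → ℂ} {f : ι → L2 p}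
    (h : ∀ i, IsMultiplier φ (m i) (f i)) (s : Finset ι) :
    IsMultiplier φ (fun ω => ∑ i ∈ s, m i ω) (∑ i ∈ s, f i) := by
  classical
  induction s using Finset.induction_on with
  | empty => simpa using isMultiplier_zero φ
  | insert i s hi ih =>
    simp_rw [Finset.sum_insert hi]
    exact (h i).add ih

/-- Continuous bounded `H^⊥`-periodic functions; the multipliers of the span of the translates
are of this kind. -/
structure IsPeriodicMultiplier (m : Vilenkin p → ℂ) : Prop where
  continuous : Continuous m
  bounded : ∃ C, ∀ ω, ‖m ω‖ ≤ C
  periodic : ∀ ω (k : Hperp p), m (ω + k) = m ω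

theorem chi_H_Hperp {h : Vilenkin p} (hh : h ∈ H p) (k : Hperp p) : chi h k = 1 := k.2 h hh

theorem isPeriodicMultiplier_chi {h : Vilenkin p} (hh : h ∈ H p) :
    IsPeriodicMultiplier fun ω => (starRingEnd ℂ) (chi h ω) where
  continuous := by
    simp_rw [chi_comm h]
    exact Complex.continuous_conj.comp (continuous_chi h)
  bounded := ⟨1, fun ω => by rw [RCLike.norm_conj, norm_chi]⟩
  periodic ω k := by rw [chi_add_right, chi_H_Hperp hh, mul_one]

theorem isPeriodicMultiplier_const (c : ℂ) :
    IsPeriodicMultiplier fun _ : Vilenkin p => c where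
  continuous := continuous_const
  bounded := ⟨‖c‖, fun _ => le_rfl⟩
  periodic _ _ := rfl

theorem IsPeriodicMultiplier.add {m n : Vilenkin p → ℂ} (hm : IsPeriodicMultiplier m)
    (hn : IsPeriodicMultiplier n) : IsPeriodicMultiplier fun ω => m ω + n ω where
  continuous := hm.continuous.add hn.continuous
  bounded := by
    obtain ⟨C, hC⟩ := hm.bounded
    obtain ⟨D, hD⟩ := hn.bounded
    exact ⟨C + D, fun ω => norm_add_le_of_le (hC ω) (hD ω)⟩
  periodic ω k := by rw [hm.periodic, hn.periodic]

theorem IsPeriodicMultiplier.mul {m n : Vilenkin p → ℂ} (hm : IsPeriodicMultiplier m)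
    (hn : IsPeriodicMultiplier n) : IsPeriodicMultiplier fun ω => m ω * n ω where
  continuous := hm.continuous.mul hn.continuous
  bounded := by
    obtain ⟨C, hC⟩ := hm.bounded
    obtain ⟨D, hD⟩ := hn.bounded
    refine ⟨C * D, fun ω => ?_⟩
    rw [norm_mul]
    exact mul_le_mul (hC ω) (hD ω) (norm_nonneg _) ((norm_nonneg _).trans (hC ω))
  periodic ω k := by rw [hm.periodic, hn.periodic]

theorem exists_isPeriodicMultiplier {φ f : L2 p}
    (hf : f ∈ Submodule.span ℂ (Set.range fun h : H p => translate (h : Vilenkin p) φ)) :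
    ∃ m, IsPeriodicMultiplier m ∧ IsMultiplier φ m f := by
  induction hf using Submodule.span_induction with
  | mem x hx =>
    obtain ⟨h, rfl⟩ := hx
    exact ⟨_, isPeriodicMultiplier_chi h.2, isMultiplier_translate _ φ⟩
  | zero => exact ⟨_, isPeriodicMultiplier_const 0, isMultiplier_zero φ⟩
  | add x y _ _ hx hy =>
    obtain ⟨m, hm, hmx⟩ := hx
    obtain ⟨n, hn, hny⟩ := hy
    exact ⟨_, hm.add hn, hmx.add hny⟩
  | smul c x _ hx =>
    obtain ⟨m, hm, hmx⟩ := hx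
    exact ⟨_, (isPeriodicMultiplier_const c).mul hm, hmx.smul c⟩

/-! ### Norms and frame coefficients as integrals against the periodization. -/

theorem IsMultiplier.enorm_sq {φ f : L2 p} {m : Vilenkin p → ℂ} (hf : IsMultiplier φ m f)
    (hm : ∀ ω (k : Hperp p), m (ω + k) = m ω) :
    ‖f‖ₑ ^ 2 = ∫⁻ ω in (U p 0 : Set (Vilenkin p)), ‖m ω‖ₑ ^ 2 * periodization φ ω ∂(haar p) := by
  rw [← lintegral_periodization f]
  refine lintegral_congr_ae (ae_restrict_of_ae ?_)
  filter_upwards [ae_forall_add hf] with ω hω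
  rw [periodization, periodization, ← ENNReal.tsum_mul_left]
  refine tsum_congr fun k => ?_
  rw [hω, hm, enorm_mul, mul_pow]

/-- By Plancherel the pairing is the integral of χ(h, ω) m(ω) |φ̂(ω)|². The first two factors are
H^⊥-periodic, so folding onto U_0 sums only |φ̂|². -/
theorem inner_translate_eq {φ f : L2 p} {m : Vilenkin p → ℂ} (hf : IsMultiplier φ m f)
    (hm : IsPeriodicMultiplier m) (hφ : ∀ᵐ ω ∂(haar p), periodization φ ω ≠ ∞)
    {h : Vilenkin p} (hh : h ∈ H p) :
    inner ℂ (translate h φ) f =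
      ∫ ω in (U p 0 : Set (Vilenkin p)),
        chi h ω * (m ω * ((periodization φ ω).toReal : ℂ)) ∂(haar p) := by
  have h1 : (fun ω => inner ℂ (fourier (translate h φ) ω) (fourier f ω)) =ᵐ[haar p]
      fun ω => chi h ω * m ω * ((‖fourier φ ω‖ ^ 2 : ℝ) : ℂ) := by
    filter_upwards [hf, isMultiplier_translate h φ] with ω h1 h2
    rw [h1, h2, RCLike.inner_apply, map_mul, Complex.conj_conj, ← Complex.normSq_eq_norm_sq,
      ← Complex.mul_conj]
    ring
  have hint := (L2.integrable_inner (𝕜 := ℂ) (fourier (translate h φ)) (fourier f)).congr h1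
  rw [← inner_fourier, L2.inner_def, integral_congr_ae h1, integral_eq_integral_tsum hint]
  refine integral_congr_ae (ae_restrict_of_ae ?_)
  filter_upwards [hφ] with ω hω
  have hchi : ∀ k : Hperp p, chi h (ω + k) = chi h ω := fun k => by
    rw [chi_add_right, chi_H_Hperp hh, mul_one]
  simp_rw [hchi, hm.periodic]
  rw [tsum_mul_left, ← mul_assoc]
  congr 1
  rw [periodization, ENNReal.tsum_toReal_eq (fun k => by finiteness), Complex.ofReal_tsum]
  simp

/-- Parseval's identity for the coefficients `⟨f, T_h φ⟩`. -/
theorem tsum_inner_translate {φ f : L2 p} {m : Vilenkin p → ℂ} (hf : IsMultiplier φ m f)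
    (hm : IsPeriodicMultiplier m) (hφ : ∀ᵐ ω ∂(haar p), periodization φ ω ≤ 1) :
    ∑' h : H p, ‖inner ℂ (translate (h : Vilenkin p) φ) f‖ₑ ^ 2 =
      ∫⁻ ω in (U p 0 : Set (Vilenkin p)), ‖m ω‖ₑ ^ 2 * periodization φ ω ^ 2 ∂(haar p) := by
  have hfin : ∀ᵐ ω ∂(haar p), periodization φ ω ≠ ∞ :=
    hφ.mono fun ω hω => (hω.trans_lt ENNReal.one_lt_top).ne
  let q : Vilenkin p → ℂ := fun ω => m ω * ((periodization φ ω).toReal : ℂ)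
  have hfm : IsFiniteMeasure ((haar p).restrict (U p 0 : Set (Vilenkin p))) :=
    ⟨by simpa using haar_U_lt_top 0⟩
  -- The bound P ≤ 1 enters here: it makes q = m P bounded on U_0, hence square integrable.
  have hq : MemLp ((U p 0 : Set (Vilenkin p)).indicator q) 2 (haar p) := by
    rw [memLp_indicator_iff_restrict (measurableSet_U 0)]
    obtain ⟨C, hC⟩ := hm.bounded
    refine MemLp.of_bound (C := C) ?_ (ae_restrict_of_ae (hφ.mono fun ω hω => ?_))
    · exact (hm.continuous.aestronglyMeasurable.mul
        (Complex.measurable_ofReal.comp_aemeasurable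
          (aemeasurable_periodization φ).ennreal_toReal).aestronglyMeasurable).restrict
    · have h1 : (periodization φ ω).toReal ≤ 1 :=
        ENNReal.toReal_le_of_le_ofReal zero_le_one (by simpa using hω)
      rw [norm_mul, Complex.norm_real, Real.norm_of_nonneg ENNReal.toReal_nonneg]
      exact (mul_le_of_le_one_right (norm_nonneg _) h1).trans (hC ω)
  -- The coefficient carries χ(h, ω) where the transform has its conjugate, hence the sign; the sum
  -- over the group is unaffected by h ↦ -h.
  have hcoef : ∀ h : Hperp p, inner ℂ (translate (h : Vilenkin p) φ) f =
      truncFourier 0 hq.toLp (-h : Hperp p) := by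
    intro h
    have hh : (h : Vilenkin p) ∈ H p := by
      rw [H_eq_Hperp]
      exact h.2
    rw [inner_translate_eq hf hm hfin hh, truncFourier_congr hq.coeFn_toLp, truncFourier]
    refine setIntegral_congr_fun (measurableSet_U 0) fun ω hω => ?_
    simp only [Set.indicator_of_mem hω, AddSubgroup.coe_neg, chi_neg_right, Complex.conj_conj]
    rw [mul_comm, chi_comm]
  have hsum : ∑' h : H p, ‖inner ℂ (translate (h : Vilenkin p) φ) f‖ₑ ^ 2 =
      ∑' h : Hperp p, ‖inner ℂ (translate (h : Vilenkin p) φ) f‖ₑ ^ 2 := by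
    rw [H_eq_Hperp]
  have hneg := (Equiv.neg (Hperp p)).tsum_eq fun k =>
    ‖truncFourier 0 hq.toLp (k : Vilenkin p)‖ₑ ^ 2
  simp only [Equiv.neg_apply] at hneg
  rw [hsum]
  simp_rw [hcoef]
  rw [hneg, tsum_truncFourier_zero, enorm_sq_eq_lintegral, ← lintegral_indicator (measurableSet_U 0)]
  · refine lintegral_congr_ae ?_
    filter_upwards [hq.coeFn_toLp, hfin] with ω hω hne
    rw [hω]
    by_cases h : ω ∈ (U p 0 : Set (Vilenkin p))
    · rw [Set.indicator_of_mem h, Set.indicator_of_mem h, enorm_mul, mul_pow]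
      congr 2
      rw [← ofReal_norm, Complex.norm_real, Real.norm_of_nonneg ENNReal.toReal_nonneg,
        ENNReal.ofReal_toReal hne]
    · rw [Set.indicator_of_notMem h, Set.indicator_of_notMem h]
      simp
  · filter_upwards [hq.coeFn_toLp] with ω hω h
    rw [hω, Set.indicator_of_notMem h]

end

end Vilenkin
-- Bessel and Parseval identities in an inner product space.
/-- Bessel's inequality with bound `1` bounds the synthesis operator by `1`. -/
theorem enorm_sum_smul_sq_le {E J : Type*} [NormedAddCommGroup E] [InnerProductSpace ℂ E]
    {V : Submodule ℂ E} {f : J → E} (hmem : ∀ j, f j ∈ V)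
    (h : ∀ v ∈ V, ∑' j, ‖inner ℂ (f j) v‖ₑ ^ 2 ≤ ‖v‖ₑ ^ 2) (s : Finset J) (c : J → ℂ) :
    ‖∑ j ∈ s, c j • f j‖ₑ ^ 2 ≤ ∑ j ∈ s, ‖c j‖ₑ ^ 2 := by
  set v := ∑ j ∈ s, c j • f j with hv
  have hvV : v ∈ V := V.sum_mem fun j _ => V.smul_mem _ (hmem j)
  have hB : ∑ j ∈ s, ‖inner ℂ (f j) v‖ ^ 2 ≤ ‖v‖ ^ 2 := by
    have h1 := (ENNReal.sum_le_tsum s).trans (h v hvV)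
    simp_rw [← ofReal_norm, ← ENNReal.ofReal_pow (norm_nonneg _)] at h1
    rw [← ENNReal.ofReal_sum_of_nonneg fun _ _ => by positivity] at h1
    exact (ENNReal.ofReal_le_ofReal_iff (by positivity)).1 h1
  have h1 : ‖v‖ ^ 2 ≤ ∑ j ∈ s, ‖c j‖ * ‖inner ℂ (f j) v‖ := by
    have h2 : inner ℂ v v = ∑ j ∈ s, (starRingEnd ℂ) (c j) * inner ℂ (f j) v := by
      conv_lhs => rw [hv, sum_inner]
      simp_rw [inner_smul_left]
      rfl
    have h3 : ‖(inner ℂ v v : ℂ)‖ = ‖v‖ ^ 2 := by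
      rw [inner_self_eq_norm_sq_to_K]
      simp
    rw [← h3, h2]
    refine (norm_sum_le _ _).trans_eq (Finset.sum_congr rfl fun j _ => ?_)
    rw [norm_mul, RCLike.norm_conj]
  -- Cauchy–Schwarz and Bessel give ‖v‖⁴ ≤ (∑ |c j|²) ‖v‖², and one factor ‖v‖² is divided out
  -- unless v = 0.
  have h2 : ‖v‖ ^ 2 ≤ ∑ j ∈ s, ‖c j‖ ^ 2 := by
    have h4 := Finset.sum_mul_sq_le_sq_mul_sq s (fun j => ‖c j‖) fun j => ‖inner ℂ (f j) v‖
    have h5 : ‖v‖ ^ 2 * ‖v‖ ^ 2 ≤ (∑ j ∈ s, ‖c j‖ ^ 2) * ‖v‖ ^ 2 :=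
      calc ‖v‖ ^ 2 * ‖v‖ ^ 2 = (‖v‖ ^ 2) ^ 2 := by ring
        _ ≤ (∑ j ∈ s, ‖c j‖ * ‖inner ℂ (f j) v‖) ^ 2 := by gcongr
        _ ≤ _ := h4.trans (by gcongr)
    rcases (sq_nonneg ‖v‖).eq_or_lt with h0 | h0
    · rw [← h0]
      positivity
    · exact le_of_mul_le_mul_right h5 h0
  simp_rw [← ofReal_norm, ← ENNReal.ofReal_pow (norm_nonneg _)]
  rw [← ENNReal.ofReal_sum_of_nonneg fun _ _ => by positivity]
  exact ENNReal.ofReal_le_ofReal h2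

/-- Each finite partial sum is continuous in v, so its bound is a closed condition. -/
theorem tsum_inner_le_of_mem_closure {E J : Type*} [NormedAddCommGroup E] [InnerProductSpace ℂ E]
    {S : Submodule ℂ E} {f : J → E}
    (h : ∀ v ∈ S, ∑' j, ‖inner ℂ (f j) v‖ₑ ^ 2 ≤ ‖v‖ₑ ^ 2) :
    ∀ v ∈ S.topologicalClosure, ∑' j, ‖inner ℂ (f j) v‖ₑ ^ 2 ≤ ‖v‖ₑ ^ 2 := by
  intro v hv
  rw [ENNReal.tsum_eq_iSup_sum]
  refine iSup_le fun s => ?_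
  have hcl : IsClosed {v : E | ∑ j ∈ s, ‖inner ℂ (f j) v‖ₑ ^ 2 ≤ ‖v‖ₑ ^ 2} := by
    refine isClosed_le ?_ ?_
    · refine continuous_finsetSum _ fun j _ => ?_
      exact (ENNReal.continuous_pow 2).comp (continuous_const.inner continuous_id).enorm
    · exact (ENNReal.continuous_pow 2).comp continuous_enorm
  exact closure_minimal (fun w hw => (ENNReal.sum_le_tsum s).trans (h w hw)) hcl hv

/-- Parseval's identity extends from a subspace to its closure. -/
theorem tsum_inner_eq_of_mem_closure {E J : Type*} [NormedAddCommGroup E] [InnerProductSpace ℂ E]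
    {S : Submodule ℂ E} {f : J → E}
    (h : ∀ v ∈ S, ∑' j, ‖inner ℂ (f j) v‖ₑ ^ 2 = ‖v‖ₑ ^ 2) :
    ∀ v ∈ S.topologicalClosure, ∑' j, ‖inner ℂ (f j) v‖ₑ ^ 2 = ‖v‖ₑ ^ 2 := by
  have hle := tsum_inner_le_of_mem_closure fun v hv => (h v hv).le
  intro v hv
  refine (hle v hv).antisymm ?_
  -- N is the ℓ² norm of the coefficients. It obeys the triangle inequality by Minkowski for
  -- counting measure, and Bessel's inequality on the closure controls N (w - v).
  let N : E → ℝ≥0∞ := fun v => (∑' j, ‖inner ℂ (f j) v‖ₑ ^ 2) ^ (1 / 2 : ℝ)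
  have hroot : ∀ w : E, (‖w‖ₑ ^ 2) ^ (1 / 2 : ℝ) = ‖w‖ₑ := fun w => by
    rw [← ENNReal.rpow_natCast, ← ENNReal.rpow_mul]
    simp
  have htri : ∀ w, N w ≤ N v + N (w - v) := by
    intro w
    letI : MeasurableSpace J := ⊤
    have := ENNReal.lintegral_Lp_add_le (μ := Measure.count) (p := 2)
      (f := fun j => ‖inner ℂ (f j) v‖ₑ) (g := fun j => ‖inner ℂ (f j) (w - v)‖ₑ)
      measurable_from_top.aemeasurable measurable_from_top.aemeasurable (by norm_num)
    simp only [ENNReal.rpow_ofNat, lintegral_count, Pi.add_apply] at this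
    refine le_trans ?_ this
    refine ENNReal.rpow_le_rpow (ENNReal.tsum_le_tsum fun j => ?_) (by norm_num)
    gcongr
    rw [← add_sub_cancel v w, inner_add_right, add_sub_cancel_left]
    exact enorm_add_le _ _
  have hbound : ∀ w ∈ S, ‖w‖ₑ ≤ N v + ‖w - v‖ₑ := by
    intro w hw
    have h1 : N w = ‖w‖ₑ := by rw [← hroot, ← h w hw]
    have h2 : N (w - v) ≤ ‖w - v‖ₑ := by
      rw [← hroot]
      exact ENNReal.rpow_le_rpow
        (hle _ (sub_mem (S.le_topologicalClosure hw) hv)) (by norm_num)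
    rw [← h1]
    exact (htri w).trans (by gcongr)
  have hcl : IsClosed {w : E | ‖w‖ₑ ≤ N v + ‖w - v‖ₑ} :=
    isClosed_le continuous_enorm (continuous_const.add (continuous_id.sub continuous_const).enorm)
  -- With v fixed, the bound is a closed condition on w that holds on S; it is now read at w = v.
  have hfin : ‖v‖ₑ ≤ N v + ‖v - v‖ₑ := closure_minimal hbound hcl hv
  rw [sub_self, enorm_zero, add_zero] at hfin
  calc ‖v‖ₑ ^ 2 ≤ N v ^ 2 := by gcongr
    _ = _ := by
      rw [← ENNReal.rpow_natCast, ← ENNReal.rpow_mul]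
      simp

theorem isParsevalFrameFor_iff {E J : Type*} [NormedAddCommGroup E] [InnerProductSpace ℂ E]
    {V : Submodule ℂ E} {f : J → E} (hmem : ∀ j, f j ∈ V) :
    IsParsevalFrameFor V f ↔ ∀ v ∈ V, ∑' j, ‖inner ℂ (f j) v‖ₑ ^ 2 = ‖v‖ₑ ^ 2 := by
  have h : ∀ v : E, ENNReal.ofReal (1 * ‖v‖ ^ 2) = ‖v‖ₑ ^ 2 := fun v => by
    rw [one_mul, ENNReal.ofReal_pow (norm_nonneg _), ofReal_norm]
  constructor
  · intro hf v hv
    exact le_antisymm ((hf.upper v hv).trans_eq (h v)) ((h v).symm.trans_le (hf.lower v hv))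
  · intro hf
    exact ⟨one_pos, le_rfl, hmem, fun v hv => (h v).trans_le (hf v hv).ge,
      fun v hv => (hf v hv).trans_le (h v).ge⟩

/-! ### The Dirichlet kernel and the bound P ≤ 1. -/

namespace Vilenkin

section
variable {p : ℕ} [NeZero p]

theorem finite_Hperp_inter_U (n : ℤ) : {k : Hperp p | (k : Vilenkin p) ∈ U p n}.Finite := by
  rw [← Set.finite_coe_iff]
  refine Finite.of_injective (β := Set.Icc (n + 1) 0 → ZMod p)
    (fun k j => (k : Hperp p).1 j) fun k l hkl => ?_
  refine Subtype.ext (Subtype.ext (ext fun j => ?_))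
  rcases le_or_gt j 0 with hj | hj
  · rcases le_or_gt j n with hn | hn
    · exact (k.2 j hn).trans (l.2 j hn).symm
    · exact congrFun hkl ⟨j, by omega, hj⟩
  · exact (mem_Hperp.1 k.1.2 j hj).trans (mem_Hperp.1 l.1.2 j hj).symm

/-- The Dirichlet kernel of the Vilenkin group. -/
theorem sum_chi_eq {n : ℤ} (hn : n ≤ 0) {ω : Vilenkin p} (hω : ω ∈ U p 0) :
    ∑ k ∈ (finite_Hperp_inter_U (p := p) n).toFinset, chi (k : Vilenkin p) ω =
      (U p (-n) : Set (Vilenkin p)).indicator (fun _ => ((haar p).real (U p n) : ℂ)) ω := by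
  have hint : Integrable ((U p n : Set (Vilenkin p)).indicator fun x => chi x ω) (haar p) :=
    (integrableOn_iff_integrable_of_support_subset Set.support_indicator_subset).1
      (integrableOn_of_memLp (memLp_indicator_chi n ω) n)
  -- The kernel is the folded integral of χ(·, ω) over U_n: for x and ω in U_0 one has χ(x + k, ω) =
  -- χ(k, ω), and x + k lies in U_n exactly when k does.
  rw [← integral_chi_eq, ← integral_indicator (measurableSet_U n), integral_eq_integral_tsum hint,
    setIntegral_congr_fun (measurableSet_U 0)
      (g := fun _ => ∑ k ∈ (finite_Hperp_inter_U (p := p) n).toFinset, chi (k : Vilenkin p) ω)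
      fun x hx => ?_]
  · rw [setIntegral_const, Measure.real, haar_U_zero]
    simp
  · have hiff : ∀ k : Hperp p, x + k ∈ U p n ↔ (k : Vilenkin p) ∈ U p n := fun k =>
      AddSubgroup.add_mem_cancel_left _ (U_anti p hn hx)
    dsimp only
    rw [tsum_eq_sum (s := (finite_Hperp_inter_U n).toFinset)]
    · refine Finset.sum_congr rfl fun k hk => ?_
      have hk' : (k : Vilenkin p) ∈ U p n := by simpa using hk
      rw [Set.indicator_of_mem ((hiff k).2 hk'), chi_add_left,
        chi_eq_one hx (by simpa using hω), one_mul]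
    · intro k hk
      exact Set.indicator_of_notMem (fun h => hk (by simpa using (hiff k).1 h)) _

theorem haar_real_U_pos (l : ℤ) : 0 < (haar p).real (U p l : Set (Vilenkin p)) :=
  ENNReal.toReal_pos (haar_U_pos l).ne' (haar_U_lt_top l).ne

theorem translate_mem_principal (φ : L2 p) (h : H p) :
    translate (h : Vilenkin p) φ ∈ principal φ :=
  Submodule.le_topologicalClosure _ (Submodule.subset_span ⟨h, rfl⟩)

theorem translate_zero (φ : L2 p) : translate 0 φ = φ := by
  refine Lp.ext ((coeFn_translate 0 φ).trans (Eventually.of_forall fun x => ?_))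
  dsimp only
  rw [sub_zero]

theorem mem_principal (φ : L2 p) : φ ∈ principal φ := by
  have := translate_mem_principal φ 0
  rwa [AddSubgroup.coe_zero, translate_zero] at this

/-- If the translates satisfy Bessel's inequality with bound `1`, then the mean values of the
periodization over balls are at most `1`. -/
theorem setLIntegral_periodization_le {φ : L2 p}
    (h : ∀ v ∈ principal φ,
      ∑' h : Hperp p, ‖inner ℂ (translate (h : Vilenkin p) φ) v‖ₑ ^ 2 ≤ ‖v‖ₑ ^ 2)
    (n : ℕ) {a : Vilenkin p} (ha : a ∈ U p 0) :
    ∫⁻ ω in coset a n, periodization φ ω ∂(haar p) ≤ haar p (U p n) := by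
  set s := (finite_Hperp_inter_U (p := p) (-n)).toFinset
  set M := (haar p).real (U p (-n) : Set (Vilenkin p)) with hM
  have hMpos : 0 < M := haar_real_U_pos _
  have hHp : ∀ k : Hperp p, (k : Vilenkin p) ∈ H p := fun k => by
    rw [H_eq_Hperp]
    exact k.2
  -- These coefficients make m the Dirichlet kernel centred at a and normalized to equal 1 there, so
  -- that on U_0 it is the indicator of a + U_n.
  let c : Hperp p → ℂ := fun k => (M : ℂ)⁻¹ * chi (k : Vilenkin p) a
  let m : Vilenkin p → ℂ := fun ω =>
    ∑ k ∈ s, c k * (starRingEnd ℂ) (chi (k : Vilenkin p) ω)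
  let f : L2 p := ∑ k ∈ s, c k • translate (k : Vilenkin p) φ
  have hmul : IsMultiplier φ m f :=
    IsMultiplier.sum (fun k : Hperp p => (isMultiplier_translate (k : Vilenkin p) φ).smul (c k)) s
  have hper : ∀ ω (k : Hperp p), m (ω + k) = m ω := fun ω k =>
    Finset.sum_congr rfl fun l _ => by rw [chi_add_right, chi_H_Hperp (hHp l), mul_one]
  have hm : ∀ ω ∈ U p 0, m ω = (coset a n).indicator (fun _ => 1) ω := by
    intro ω hω
    have h1 := sum_chi_eq (n := -n) (by omega) ((U p 0).sub_mem ha hω)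
    have h2 : m ω = (M : ℂ)⁻¹ * ∑ k ∈ s, chi (k : Vilenkin p) (a - ω) := by
      rw [Finset.mul_sum]
      refine Finset.sum_congr rfl fun k _ => ?_
      rw [sub_eq_add_neg, chi_add_right, chi_neg_right, mul_assoc]
    rw [h2, h1, neg_neg]
    by_cases hc : ω ∈ coset a n
    · rw [Set.indicator_of_mem hc, Set.indicator_of_mem (by exact mem_coset_comm.1 hc),
        inv_mul_cancel₀ (by exact_mod_cast hMpos.ne')]
    · rw [Set.indicator_of_notMem hc,
        Set.indicator_of_notMem (by exact fun h' => hc (mem_coset_comm.1 h')), mul_zero]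
  have hsub : coset a n ⊆ (U p 0 : Set (Vilenkin p)) := fun x hx => by
    have := (U p 0).add_mem (U_anti p (Int.natCast_nonneg n) hx) ha
    rwa [sub_add_cancel] at this
  have hf : ‖f‖ₑ ^ 2 = ∫⁻ ω in coset a n, periodization φ ω ∂(haar p) := by
    rw [hmul.enorm_sq hper, ← Set.inter_eq_self_of_subset_left hsub,
      ← setLIntegral_indicator (measurableSet_coset a n)]
    refine setLIntegral_congr_fun (measurableSet_U 0) fun ω hω => ?_
    rw [hm ω hω]
    by_cases hc : ω ∈ coset a n
    · rw [Set.indicator_of_mem hc, Set.indicator_of_mem hc]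
      simp
    · rw [Set.indicator_of_notMem hc, Set.indicator_of_notMem hc]
      simp
  -- The number of terms is the value of the Dirichlet kernel at 0. With M terms, each of squared
  -- size M⁻², the final bound is M⁻¹ = μ(U_n).
  have hcard : (s.card : ℝ) = M := by
    have h1 := sum_chi_eq (p := p) (n := -n) (by omega) (U p 0).zero_mem
    rw [Set.indicator_of_mem (U p (- -(n : ℤ))).zero_mem] at h1
    simp_rw [chi_zero_right] at h1
    rw [Finset.sum_const, nsmul_eq_mul, mul_one] at h1
    exact_mod_cast h1
  have hc : ∀ k, ‖c k‖ₑ ^ 2 = ENNReal.ofReal (M⁻¹ ^ 2) := fun k => by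
    rw [← ofReal_norm, ← ENNReal.ofReal_pow (norm_nonneg _), norm_mul, norm_chi, mul_one,
      norm_inv, Complex.norm_real, Real.norm_of_nonneg hMpos.le]
  rw [← hf]
  refine (enorm_sum_smul_sq_le (fun k : Hperp p => translate_mem_principal φ ⟨k, hHp k⟩) h s
    c).trans ?_
  simp_rw [hc]
  rw [Finset.sum_const, nsmul_eq_mul, ← ENNReal.ofReal_natCast, hcard,
    ← ENNReal.ofReal_mul hMpos.le]
  have h1 : M * M⁻¹ ^ 2 = M⁻¹ := by
    field_simp
  rw [h1, ENNReal.ofReal_inv_of_pos hMpos, hM, ofReal_measureReal (haar_U_lt_top _).ne]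
  exact (ENNReal.eq_inv_of_mul_eq_one_left (haar_U_mul _)).ge

/-- The measure on U_0 with density P is dominated by Haar measure on balls, hence on all sets by
outer regularity. Comparing densities gives the bound on U_0, and periodicity spreads it. -/
theorem periodization_le_one {φ : L2 p}
    (h : ∀ v ∈ principal φ,
      ∑' h : Hperp p, ‖inner ℂ (translate (h : Vilenkin p) φ) v‖ₑ ^ 2 ≤ ‖v‖ₑ ^ 2) :
    ∀ᵐ ω ∂(haar p), periodization φ ω ≤ 1 := by
  have hν : ((haar p).restrict (U p 0 : Set (Vilenkin p))).withDensity (periodization φ) ≤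
      haar p := by
    refine measure_le_of_forall_coset fun n a => ?_
    rw [withDensity_apply _ (measurableSet_coset a n),
      Measure.restrict_restrict (measurableSet_coset a n)]
    by_cases ha : a ∈ U p 0
    · rw [haar_coset]
      exact (lintegral_mono_set Set.inter_subset_left).trans (setLIntegral_periodization_le h n ha)
    · have hempty : coset a n ∩ (U p 0 : Set (Vilenkin p)) = ∅ := by
        rw [Set.eq_empty_iff_forall_notMem]
        rintro x ⟨hx, hU⟩
        have := (U p 0).sub_mem hU (U_anti p (Int.natCast_nonneg n) hx)
        rw [sub_sub_cancel] at this
        exact ha this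
      rw [hempty]
      simp
  have hU : ∀ᵐ ω ∂((haar p).restrict (U p 0 : Set (Vilenkin p))), periodization φ ω ≤ 1 := by
    refine ae_le_of_forall_setLIntegral_le_of_sigmaFinite₀
      (aemeasurable_periodization φ).restrict fun s hs _ => ?_
    have := hν (s ∩ (U p 0 : Set (Vilenkin p)))
    rw [withDensity_apply _ (hs.inter (measurableSet_U 0)), Measure.restrict_restrict
      (hs.inter (measurableSet_U 0)), Set.inter_assoc, Set.inter_self] at this
    rw [setLIntegral_const, one_mul, Measure.restrict_apply hs, Measure.restrict_restrict hs]
    exact this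
  rw [ae_restrict_iff' (measurableSet_U 0)] at hU
  exact ae_of_ae_U (fun ω k hk => by rwa [periodization_add] at hk) hU

/-! ### Parseval frames and idempotent periodizations. -/

/-- The solutions of t = t² in [0, ∞] are 0, 1 and ∞; the inequality is there to exclude ∞. -/
theorem supportSet_indicator_apply (φ : L2 p) (ω : Vilenkin p) :
    periodization φ ω = (supportSet φ).indicator (fun _ => (1 : ℝ≥0∞)) ω ↔
      periodization φ ω = periodization φ ω ^ 2 ∧ periodization φ ω ≤ 1 := by
  by_cases h : periodization φ ω = 0
  · rw [Set.indicator_of_notMem (by simpa [supportSet] using h), h]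
    simp
  · rw [Set.indicator_of_mem h]
    constructor
    · intro h1
      rw [h1]
      simp
    · rintro ⟨h1, h2⟩
      rw [sq] at h1
      exact (ENNReal.mul_right_inj h (h2.trans_lt ENNReal.one_lt_top).ne).1
        (by rw [mul_one]; exact h1.symm)

theorem isParsevalFrameFor_iff_periodization (φ : L2 p) :
    IsParsevalFrameFor (principal φ) (fun h : H p => translate (h : Vilenkin p) φ) ↔
      ∀ᵐ ω ∂(haar p), periodization φ ω =
        (supportSet φ).indicator (fun _ => (1 : ℝ≥0∞)) ω := by
  rw [isParsevalFrameFor_iff (translate_mem_principal φ)]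
  simp_rw [supportSet_indicator_apply]
  constructor
  · intro h
    have hle : ∀ᵐ ω ∂(haar p), periodization φ ω ≤ 1 := by
      refine periodization_le_one fun v hv => (le_of_eq ?_).trans (h v hv).le
      rw [H_eq_Hperp]
    have h1 := tsum_inner_translate (isMultiplier_self φ) (isPeriodicMultiplier_const 1) hle
    rw [h φ (mem_principal φ), ← lintegral_periodization φ] at h1
    simp only [enorm_one, one_pow, one_mul] at h1
    -- P² ≤ P, and both have the same finite integral over U_0 by the frame identity at f = φ, so
    -- they agree a.e. on U_0.
    have hU := ae_eq_of_ae_le_of_lintegral_le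
      (ae_restrict_of_ae (hle.mono fun ω hω => by
        simpa [sq] using mul_le_mul_right hω (periodization φ ω)))
      (by rw [← h1, lintegral_periodization]; finiteness)
      (aemeasurable_periodization φ).restrict h1.le
    filter_upwards [hle, ae_of_ae_U
      (Q := fun ω => periodization φ ω = periodization φ ω ^ 2)
      (fun ω k hk => by rwa [periodization_add] at hk)
      ((ae_restrict_iff' (measurableSet_U 0)).1 (hU.mono fun ω hω => hω.symm))] with ω h2 h3
    exact ⟨h3, h2⟩
  · intro h
    refine tsum_inner_eq_of_mem_closure fun v hv => ?_
    obtain ⟨m, hm, hmv⟩ := exists_isPeriodicMultiplier hv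
    rw [tsum_inner_translate hmv hm (h.mono fun ω hω => hω.2), hmv.enorm_sq hm.periodic]
    refine lintegral_congr_ae (ae_restrict_of_ae (h.mono fun ω hω => ?_))
    dsimp only
    rw [← hω.1]

/-! ### The spectrum of ⟨φ⟩. -/

/-- The Fourier transforms of the elements of `⟨φ⟩` vanish where the periodization of `φ` does. -/
theorem fourier_eq_zero_of_mem_principal {φ f : L2 p} (hf : f ∈ principal φ) :
    ∀ᵐ ω ∂(haar p), periodization φ ω = 0 → fourier f ω = 0 := by
  obtain ⟨u, hu, hlim⟩ := mem_closure_iff_seq_limit.1 hf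
  have h1 : Tendsto (fun n => fourier (u n)) atTop (𝓝 (fourier f)) :=
    (continuous_fourier.tendsto f).comp hlim
  obtain ⟨ns, -, hae⟩ := TendstoInMeasure.exists_seq_tendsto_ae (tendstoInMeasure_of_tendsto_Lp h1)
  have h2 : ∀ᵐ ω ∂(haar p), ∀ n, periodization φ ω = 0 → fourier (u n) ω = 0 := by
    rw [ae_all_iff]
    intro n
    obtain ⟨m, -, hm⟩ := exists_isPeriodicMultiplier (hu n)
    filter_upwards [hm] with ω hω h0
    have := ENNReal.tsum_eq_zero.1 h0 0
    rw [hω]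
    simp_all
  filter_upwards [hae, h2] with ω h3 h4 h0
  exact tendsto_nhds_unique h3 (tendsto_const_nhds.congr fun i => (h4 _ h0).symm)

theorem fiber_ne_zero_iff (φ : L2 p) (ω : Vilenkin p) :
    fiber φ ω ≠ 0 ↔ periodization φ ω ≠ 0 := by
  rw [not_iff_not, periodization, ENNReal.tsum_eq_zero, funext_iff]
  simp [fiber]

theorem mem_spectrum_add_iff (S : Submodule ℂ (L2 p)) (ω : Vilenkin p) :
    ω ∈ spectrum S + (Hperp p : Set (Vilenkin p)) ↔ ∃ k : Hperp p, ω + k ∈ spectrum S := by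
  rw [Set.mem_add]
  constructor
  · rintro ⟨x, hx, k, hk, rfl⟩
    exact ⟨-⟨k, hk⟩, by simpa using hx⟩
  · rintro ⟨k, hk⟩
    exact ⟨_, hk, -k, (Hperp p).neg_mem k.2, by simp⟩

/-- One inclusion holds because a dense sequence in ⟨φ⟩ has zero fibres wherever P vanishes. For the
other, a point of the support is moved into U_0 by an element of H^⊥, where φ itself has a non-zero
fibre. -/
theorem ae_mem_spectrum_add_iff (φ : L2 p) :
    ∀ᵐ ω ∂(haar p), ω ∈ spectrum (principal φ) + (Hperp p : Set (Vilenkin p)) ↔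
      ω ∈ supportSet φ := by
  have h1 := ae_forall_add (ae_mem_spectrum_of_fiber_ne_zero (mem_principal φ))
  have h2 : ∀ᵐ ω ∂(haar p), ∀ n : ℕ, periodization φ ω = 0 →
      fourier (TopologicalSpace.denseSeq (principal φ) n : L2 p) ω = 0 :=
    ae_all_iff.2 fun n => fourier_eq_zero_of_mem_principal
      (TopologicalSpace.denseSeq (principal φ) n).2
  filter_upwards [h1, ae_forall_add h2] with ω hω hω'
  rw [mem_spectrum_add_iff]
  constructor
  · rintro ⟨k, -, n, hn⟩ h0
    refine hn (funext fun l => ?_)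
    have := hω' (k + l) n (by rw [periodization_add, h0])
    rwa [AddSubgroup.coe_add, ← add_assoc] at this
  · intro h0
    obtain ⟨k, hk⟩ := exists_add_mem_U ω
    refine ⟨k, hω k hk ((fiber_ne_zero_iff _ _).2 ?_)⟩
    rwa [periodization_add]

end

end Vilenkin

theorem mainTheorem5 (p : ℕ) [NeZero p] (φ : Vilenkin.L2 p) :
    List.TFAE
      [IsParsevalFrameFor (Vilenkin.principal φ)
          (fun h : Vilenkin.H p => Vilenkin.translate (h : Vilenkin p) φ),
        ∀ᵐ ω ∂(Vilenkin.haar p : Measure (VilenkinDual p)),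
          ∑' h : Vilenkin.Hperp p, ‖Vilenkin.fourier φ (ω + h)‖ₑ ^ 2 =
            (Vilenkin.supportSet φ).indicator (fun _ => (1 : ℝ≥0∞)) ω,
        ∀ᵐ ω ∂(Vilenkin.haar p : Measure (VilenkinDual p)),
          ∑' h : Vilenkin.Hperp p, ‖Vilenkin.fourier φ (ω + h)‖ₑ ^ 2 =
            (Vilenkin.spectrum (Vilenkin.principal φ) +
              (Vilenkin.Hperp p : Set (VilenkinDual p))).indicator (fun _ => (1 : ℝ≥0∞)) ω] := by
  tfae_have 1 ↔ 2 := Vilenkin.isParsevalFrameFor_iff_periodization φ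
  tfae_have 2 ↔ 3 := by
    refine eventually_congr ((Vilenkin.ae_mem_spectrum_add_iff φ).mono fun ω hω => ?_)
    by_cases h : ω ∈ Vilenkin.supportSet φ
    · rw [Set.indicator_of_mem h, Set.indicator_of_mem (hω.2 h)]
    · rw [Set.indicator_of_notMem h, Set.indicator_of_notMem fun h' => h (hω.1 h')]
  tfae_finish
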